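/- Let $A_1,A_2\in\mathbb R^{n\times n}$ and $c\in\mathbb R^n$, and consider the bimodal piecewise linear differential inclusion $\dot x(t)\in G(x(t))$, where $G(x)=\{A_1x\}$ if $c^Tx<0$, $G(x)=\operatorname{conv}\{A_1x,A_2x\}$ if $c^Tx=0$, and $G(x)=\{A_2x\}$ if $c^Tx>0$. A Filippov solution for the initial state $\xi\in\mathbb R^n$ is a function $x:\mathbb R\to\mathbb R^n$, absolutely continuous on every compact interval, with $x(0)=\xi$ and $\dot x(t)\in G(x(t))$ for almost all $t\in\mathbb R$. It is called unique if every Filippov solution $x'$ for the same $\xi$ satisfies $x'(t)=x(t)$ for all $t\in\mathbb R$, and right-unique if for every Filippov solution $x'$ for the same $\xi$ there is $\epsilon>0$ with $x'(t)=x(t)$ for all $t\in[0,\epsilon)$. For $i=1,2$ and $k\ge 0$ let $T_i^k$ be the $(k+1)\times n$ matrix with rows $c^T,c^TA_i,\dots,c^TA_i^k$, and let $h_i$ be the observability index of $(c^T,A_i)$, i.e. the largest integer $k\ge 0$ such that $T_i^k$ has full row rank (with $h_i:=0$ if $c=0$). Then the following are equivalent: (a) every Filippov solution (for every initial state) is unique;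 (b) every Filippov solution (for every initial state) is right-unique; (c) the following three conditions hold: 1. $h_1=h_2$; 2. there exists an $(h_1+1)\times(h_1+1)$ lower triangular matrix $M$ with positive diagonal elements such that $T_1^{h_1}=M\,T_2^{h_1}$; 3. for all $x\in\mathbb R^n$, $T_1^{h_1}x=0$ implies $A_1x=A_2x$. -/

import Mathlib

open Matrix MeasureTheory

noncomputable section

/-- The convexified set-valued right-hand side `G` of the bimodal piecewise affine system:
mode 1 (`A₁ x + e₁`) on `cᵀx + f < 0`, mode 2 (`A₂ x + e₂`) on `cᵀx + f > 0`, and the convex hull of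
the two vectors on the switching hyperplane. -/
def filippovMap {n : ℕ} (A₁ A₂ : Matrix (Fin n) (Fin n) ℝ) (e₁ e₂ c : Fin n → ℝ) (f : ℝ)
    (x : Fin n → ℝ) : Set (Fin n → ℝ) :=
  if c ⬝ᵥ x + f < 0 then {A₁ *ᵥ x + e₁}
  else if c ⬝ᵥ x + f = 0 then convexHull ℝ {A₁ *ᵥ x + e₁, A₂ *ᵥ x + e₂}
  else {A₂ *ᵥ x + e₂}

/-- `x : ℝ → ℝⁿ` is a Filippov solution for the initial state `ξ`: it is absolutely continuous
(on every compact interval), `x 0 = ξ`, and for almost every `t` it is differentiable at `t` with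
derivative in `G (x t)`. (Neither absolute continuity nor the derivative depends on the choice of
the norm on `ℝⁿ`.) -/
def IsFilippovSolution {n : ℕ} (A₁ A₂ : Matrix (Fin n) (Fin n) ℝ) (e₁ e₂ c : Fin n → ℝ) (f : ℝ)
    (ξ : Fin n → ℝ) (x : ℝ → Fin n → ℝ) : Prop :=
  (∀ a b : ℝ, AbsolutelyContinuousOnInterval x a b) ∧ x 0 = ξ ∧
    ∀ᵐ t : ℝ, ∃ v ∈ filippovMap A₁ A₂ e₁ e₂ c f (x t), HasDerivAt x v t

/-- The function `x` (meant to be a Filippov solution for the initial state `ξ`) is right-unique: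
every Filippov solution for `ξ` agrees with it on some interval `[0, ε)`. -/
def IsRightUnique {n : ℕ} (A₁ A₂ : Matrix (Fin n) (Fin n) ℝ) (e₁ e₂ c : Fin n → ℝ) (f : ℝ)
    (ξ : Fin n → ℝ) (x : ℝ → Fin n → ℝ) : Prop :=
  ∀ x' : ℝ → Fin n → ℝ, IsFilippovSolution A₁ A₂ e₁ e₂ c f ξ x' →
    ∃ ε > 0, ∀ t ∈ Set.Ico (0 : ℝ) ε, x t = x' t

/-- The function `x` (meant to be a Filippov solution for the initial state `ξ`) is unique:
every Filippov solution for `ξ` agrees with it on the whole time axis. -/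
def IsUniqueSolution {n : ℕ} (A₁ A₂ : Matrix (Fin n) (Fin n) ℝ) (e₁ e₂ c : Fin n → ℝ) (f : ℝ)
    (ξ : Fin n → ℝ) (x : ℝ → Fin n → ℝ) : Prop :=
  ∀ x' : ℝ → Fin n → ℝ, IsFilippovSolution A₁ A₂ e₁ e₂ c f ξ x' → ∀ t : ℝ, x t = x' t

/-- The stacked matrix `col(cᵀ, cᵀA, …, cᵀAᵏ)`, with `k + 1` rows. -/
def obsMatrix {n : ℕ} (c : Fin n → ℝ) (A : Matrix (Fin n) (Fin n) ℝ) (k : ℕ) :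
    Matrix (Fin (k + 1)) (Fin n) ℝ :=
  Matrix.of fun i => c ᵥ* A ^ (i : ℕ)

/-- The observability index of `(cᵀ, A)`: the largest `k` such that `col(cᵀ, cᵀA, …, cᵀAᵏ)` has
full row rank (i.e. linearly independent rows). For `c = 0` no such `k` exists, and the value is
`0` by convention. -/
def observabilityIndex {n : ℕ} (c : Fin n → ℝ) (A : Matrix (Fin n) (Fin n) ℝ) : ℕ :=
  sSup {k : ℕ | LinearIndependent ℝ (obsMatrix c A k).row}

/-- For `c ≠ 0` the observability index is a genuine maximum. -/
theorem observabilityIndex_isGreatest {n : ℕ} (c : Fin n → ℝ) (hc : c ≠ 0)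
    (A : Matrix (Fin n) (Fin n) ℝ) :
    IsGreatest {k : ℕ | LinearIndependent ℝ (obsMatrix c A k).row} (observabilityIndex c A) := by
  have hbdd : BddAbove {k : ℕ | LinearIndependent ℝ (obsMatrix c A k).row} := by
    refine ⟨n, fun k hk => ?_⟩
    have h := LinearIndependent.fintype_card_le_finrank hk
    simp at h
    omega
  have hne : {k : ℕ | LinearIndependent ℝ (obsMatrix c A k).row}.Nonempty := by
    refine ⟨0, ?_⟩
    refine LinearIndependent.of_subsingleton (ι := Fin 1) 0 ?_
    intro h
    apply hc
    have h' : c ᵥ* A ^ 0 = 0 := h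
    simpa using h'
  exact ⟨Nat.sSup_mem hne hbdd, fun k hk => le_csSup hbdd hk⟩

end

/-! Sufficiency. Under the algebraic conditions the functionals `c ᵥ* A₂ ^ i` form a chain for both
modes: each is mapped to a positive multiple of the next plus a combination of itself and its
predecessors (`IsIntegratorChain.of_lowerTriangular`). Positivity of the gains and this triangular
form survive convex combination, so they hold along every Filippov solution, however it slides or
switches. If the first chain functional that does not vanish at the initial state has a sign there,
the output `c ⬝ᵥ x` takes that sign for small positive times (`chain_pos`), so a single mode is
active and linear uniqueness applies. If all of them vanish, Gronwall keeps them zero, and there the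
modes agree. Right uniqueness propagates forward by continuity, and backward by time reversal.

Necessity. If the mode 1 flow from `ξ` starts into `c ⬝ᵥ x < 0` or stays on the hyperplane, and the
mode 2 flow starts into `c ⬝ᵥ x > 0` or stays, both are Filippov solutions for a short time.
Solutions live on all of `ℝ`, so the two pieces must be extended; this is why an existence theorem
is needed, proved by Euler schemes. Right uniqueness then forces both flows to stay on the
hyperplane and the modes to agree at `ξ` (`isUnobservable_of_rightUnique`). Applied to `ξ` and `-ξ`,
this shows that the unobservable subspaces coincide and that lexicographic positivity of the output
derivatives passes from mode 2 to mode 1. Equal kernels give equal indices and a factor `M`;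
preservation of lexicographic positivity makes `M` lower triangular with nonnegative diagonal, and
invertibility makes the diagonal positive. -/

/-! ### Differential inequalities and growth along integrator chains -/

/-- An absolutely continuous function with a.e. nonnegative derivative is monotone. -/
theorem AbsolutelyContinuousOnInterval.le_of_ae_deriv_nonneg {f : ℝ → ℝ} {a b : ℝ} (hab : a ≤ b)
    (hf : AbsolutelyContinuousOnInterval f a b)
    (h : ∀ᵐ t : ℝ, t ∈ Set.Ioo a b → ∃ v, 0 ≤ v ∧ HasDerivAt f v t) : f a ≤ f b := by
  have h1 := hf.integral_deriv_eq_sub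
  have h2 : 0 ≤ ∫ t in a..b, deriv f t := by
    rw [intervalIntegral.integral_of_le hab, integral_Ioc_eq_integral_Ioo]
    refine setIntegral_nonneg_of_ae_restrict ?_
    rw [Filter.EventuallyLE, ae_restrict_iff' measurableSet_Ioo]
    filter_upwards [h] with t ht hmem
    obtain ⟨v, hv, hd⟩ := ht hmem
    simpa [hd.deriv] using hv
  linarith

/-- Scalar Gronwall inequality for absolutely continuous functions. -/
theorem AbsolutelyContinuousOnInterval.nonpos_of_ae_deriv_le {u : ℝ → ℝ} {T K : ℝ} (hT : 0 ≤ T)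
    (hu : AbsolutelyContinuousOnInterval u 0 T) (h0 : u 0 ≤ 0)
    (h : ∀ᵐ t : ℝ, t ∈ Set.Ioo 0 T → ∃ v, v ≤ K * u t ∧ HasDerivAt u v t) : u T ≤ 0 := by
  -- Integrating factor, negated so that the product with `u` is nondecreasing.
  have hexp : AbsolutelyContinuousOnInterval (fun t => -Real.exp (-K * t)) 0 T :=
    ContDiffOn.absolutelyContinuousOnInterval (by fun_prop)
  have := (hexp.mul hu).le_of_ae_deriv_nonneg hT (by
    filter_upwards [h] with t ht hmem
    obtain ⟨v, hv, hd⟩ := ht hmem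
    have he : HasDerivAt (fun t => -Real.exp (-K * t)) (-(Real.exp (-K * t) * (-K))) t := by
      have hlin : HasDerivAt (fun t => -K * t) (-K) t := by
        simpa using (hasDerivAt_id t).const_mul (-K)
      exact hlin.exp.fun_neg
    refine ⟨_, ?_, he.mul hd⟩
    have : 0 ≤ Real.exp (-K * t) * (K * u t - v) := mul_nonneg (Real.exp_pos _).le (by linarith)
    linarith)
  simp only [Pi.mul_apply] at this
  have h3 : Real.exp (-K * T) * u T ≤ 0 := by
    have h4 : Real.exp (-K * 0) * u 0 ≤ 0 := mul_nonpos_of_nonneg_of_nonpos (Real.exp_pos _).le h0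
    linarith
  exact nonpos_of_mul_nonpos_right h3 (Real.exp_pos _)

theorem AbsolutelyContinuousOnInterval.fun_sum {ι : Type*} (s : Finset ι) {f : ι → ℝ → ℝ} {a b : ℝ}
    (hf : ∀ i ∈ s, AbsolutelyContinuousOnInterval (f i) a b) :
    AbsolutelyContinuousOnInterval (fun t => ∑ i ∈ s, f i t) a b := by
  classical
  induction s using Finset.induction_on with
  | empty =>
    simpa using (contDiffOn_const (c := (0 : ℝ)) (n := 1) (𝕜 := ℝ)
      (s := Set.uIcc a b)).absolutelyContinuousOnInterval
  | insert i s hi ih =>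
    simp only [Finset.sum_insert hi]
    exact (hf i (by simp)).add (ih fun j hj => hf j (by simp [hj]))

/-- Gronwall inequality for a finite family of absolutely continuous functions. -/
theorem eq_zero_of_ae_abs_deriv_le {ι : Type*} (s : Finset ι) {z : ι → ℝ → ℝ} {T B : ℝ}
    (hT : 0 ≤ T) (hB : 0 ≤ B) (hz : ∀ i ∈ s, AbsolutelyContinuousOnInterval (z i) 0 T)
    (h0 : ∀ i ∈ s, z i 0 = 0)
    (h : ∀ᵐ t : ℝ, t ∈ Set.Ioo 0 T → ∀ i ∈ s, ∃ v, |v| ≤ B * ∑ j ∈ s, |z j t| ∧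
      HasDerivAt (z i) v t) : ∀ i ∈ s, z i T = 0 := by
  -- The sum of squares is smooth in the `z i`, unlike the sum of absolute values; Cauchy–Schwarz
  -- compares the two and puts the factor `s.card` into the Gronwall constant.
  have hac : AbsolutelyContinuousOnInterval (fun t => ∑ i ∈ s, z i t * z i t) 0 T :=
    AbsolutelyContinuousOnInterval.fun_sum s fun i hi => (hz i hi).mul (hz i hi)
  have hle : ∑ i ∈ s, z i T * z i T ≤ 0 := by
    refine hac.nonpos_of_ae_deriv_le (K := 2 * B * s.card) hT ?_ ?_
    · exact (Finset.sum_eq_zero fun i hi => by rw [h0 i hi, zero_mul]).le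
    filter_upwards [h] with t ht hmem
    choose! v hv hd using ht hmem
    refine ⟨∑ i ∈ s, (v i * z i t + z i t * v i), ?_, ?_⟩
    · have h1 : ∑ i ∈ s, (v i * z i t + z i t * v i) ≤
          ∑ i ∈ s, 2 * (B * ∑ j ∈ s, |z j t|) * |z i t| := by
        refine Finset.sum_le_sum fun i hi => ?_
        have h2 : v i * z i t ≤ |v i| * |z i t| := by rw [← abs_mul]; exact le_abs_self _
        have h3 := mul_le_mul_of_nonneg_right (hv i hi) (abs_nonneg (z i t))
        linarith
      rw [← Finset.mul_sum] at h1
      have h4 : (∑ j ∈ s, |z j t|) ^ 2 ≤ s.card * ∑ j ∈ s, |z j t| ^ 2 := sq_sum_le_card_mul_sum_sq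
      have h5 : ∑ j ∈ s, |z j t| ^ 2 = ∑ i ∈ s, z i t * z i t :=
        Finset.sum_congr rfl fun j _ => by rw [sq_abs, sq]
      rw [h5] at h4
      have h6 := mul_le_mul_of_nonneg_left h4 (by positivity : 0 ≤ 2 * B)
      calc _ ≤ _ := h1
        _ = 2 * B * (∑ j ∈ s, |z j t|) ^ 2 := by ring
        _ ≤ _ := h6
        _ = _ := by ring
    · exact HasDerivAt.fun_sum fun i hi => (hd i hi).mul (hd i hi)
  intro i hi
  have h7 := (Finset.sum_eq_zero_iff_of_nonneg fun i _ => mul_self_nonneg (z i T)).1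
    (le_antisymm hle (Finset.sum_nonneg fun i _ => mul_self_nonneg _)) i hi
  exact mul_self_eq_zero.1 h7

/-- Polynomial growth estimates along a chain of integrators started at the origin: the components
of index at most `k - m` are `O(t ^ m)`, and the one of index `k - m` is bounded below by
a positive multiple of `t ^ m`. -/
theorem chain_growth {k : ℕ} {z : ℕ → ℝ → ℝ} {T α B : ℝ} (hT : 0 < T) (hα : 0 < α) (hB : 0 ≤ B)
    (hz : ∀ j ≤ k, AbsolutelyContinuousOnInterval (z j) 0 T) (h0 : ∀ j < k, z j 0 = 0)
    (hk : 0 < z k 0)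
    (h : ∀ᵐ t : ℝ, t ∈ Set.Ioo 0 T → ∀ i < k, ∃ v a, α ≤ a ∧ a ≤ B ∧
      |v - a * z (i + 1) t| ≤ B * ∑ j ∈ Finset.range (i + 1), |z j t| ∧ HasDerivAt (z i) v t)
    (m : ℕ) (hm : m ≤ k) :
    ∃ τ δ C : ℝ, 0 < τ ∧ τ ≤ T ∧ 0 < δ ∧ 0 ≤ C ∧ ∀ t ∈ Set.Icc 0 τ,
      (∀ j ≤ k - m, |z j t| ≤ C * t ^ m) ∧ δ * t ^ m ≤ z (k - m) t := by
  induction m with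
  | zero =>
    have hb : ∀ j, ∃ C, j ≤ k → ∀ t ∈ Set.Icc 0 T, |z j t| ≤ C := by
      intro j
      by_cases hj : j ≤ k
      · obtain ⟨C, hC⟩ := (hz j hj).exists_bound
        rw [Set.uIcc_of_le hT.le] at hC
        exact ⟨C, fun _ => hC⟩
      · exact ⟨0, fun h => absurd h hj⟩
    choose C hC using hb
    have hcont := (hz k le_rfl).continuousOn
    rw [Set.uIcc_of_le hT.le] at hcont
    have hev : ∀ᶠ t in nhdsWithin (0 : ℝ) (Set.Icc 0 T), z k 0 / 2 < z k t :=
      (hcont 0 ⟨le_rfl, hT.le⟩).eventually_const_lt (by linarith)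
    obtain ⟨ε, hε, hball⟩ := Metric.mem_nhdsWithin_iff.1 hev
    refine ⟨min T (ε / 2), z k 0 / 2, ∑ j ∈ Finset.range (k + 1), |C j|, by positivity,
      min_le_left _ _, by positivity, Finset.sum_nonneg fun _ _ => abs_nonneg _, ?_⟩
    intro t ht
    have htT : t ∈ Set.Icc 0 T := ⟨ht.1, ht.2.trans (min_le_left _ _)⟩
    refine ⟨fun j hj => ?_, ?_⟩
    · have h1 := hC j (by omega) t htT
      have h2 : |C j| ≤ ∑ j ∈ Finset.range (k + 1), |C j| :=
        Finset.single_le_sum (f := fun j => |C j|) (fun _ _ => abs_nonneg _)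
          (Finset.mem_range.2 (by omega))
      simpa using (h1.trans (le_abs_self _)).trans h2
    · have h3 : t ∈ Metric.ball 0 ε ∩ Set.Icc 0 T := by
        refine ⟨?_, htT⟩
        rw [mem_ball_zero_iff, Real.norm_eq_abs, abs_of_nonneg ht.1]
        have := ht.2.trans (min_le_right _ _)
        linarith
      have h4 := hball h3
      simp only [Set.mem_ofPred_eq] at h4
      simpa using h4.le
  | succ m ih =>
    obtain ⟨τ, δ, C, hτ, hτT, hδ, hC, H⟩ := ih (by omega)
    obtain ⟨p, hp⟩ : ∃ p, k = p + m + 1 := ⟨k - m - 1, by omega⟩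
    have hpm : k - m = p + 1 := by omega
    have hpm' : k - (m + 1) = p := by omega
    rw [hpm']
    rw [hpm] at H
    -- For `j ≤ p` both the gain term and the lower terms are `O(t ^ m)`, with total constant `D`.
    -- Integration gains one power of `t`; the factor `1 / (m + 1)` is thrown away.
    set D : ℝ := B * C + B * ((k + 1) * C) with hD
    have hD0 : 0 ≤ D := by positivity
    have hsub : ∀ t ∈ Set.Icc 0 τ, ∀ j ≤ k, AbsolutelyContinuousOnInterval (z j) 0 t := by
      intro t ht j hj
      refine (hz j hj).mono ?_
      rw [Set.uIcc_of_le ht.1, Set.uIcc_of_le hT.le]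
      exact Set.Icc_subset_Icc_right (ht.2.trans hτT)
    have hpow : ∀ (E : ℝ) (t : ℝ), AbsolutelyContinuousOnInterval (fun s => E * s ^ (m + 1)) 0 t :=
      fun E t => ContDiffOn.absolutelyContinuousOnInterval (by fun_prop)
    have hpowd : ∀ (E : ℝ) (t : ℝ), HasDerivAt (fun s => E * s ^ (m + 1))
        (E * (((m + 1 : ℕ) : ℝ) * t ^ m)) t := fun E t => by
      simpa using (hasDerivAt_pow (m + 1) t).const_mul E
    have hup : ∀ t ∈ Set.Icc 0 τ, ∀ j ≤ p, |z j t| ≤ D * t ^ (m + 1) := by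
      intro t ht j hj
      have hder : ∀ᵐ s : ℝ, s ∈ Set.Ioo 0 t → ∃ v, |v| ≤ D * (((m + 1 : ℕ) : ℝ) * s ^ m) ∧
          HasDerivAt (z j) v s := by
        filter_upwards [h] with s hs hmem
        have hsτ : s ∈ Set.Icc 0 τ := ⟨hmem.1.le, hmem.2.le.trans ht.2⟩
        obtain ⟨v, a, ha, haB, hv, hd⟩ := hs ⟨hmem.1, hmem.2.trans_le (ht.2.trans hτT)⟩ j (by omega)
        refine ⟨v, ?_, hd⟩
        have h1 : ∑ i ∈ Finset.range (j + 1), |z i s| ≤ (k + 1) * (C * s ^ m) := by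
          calc _ ≤ ∑ i ∈ Finset.range (j + 1), C * s ^ m := Finset.sum_le_sum fun i hi =>
                (H s hsτ).1 i (by have := Finset.mem_range.1 hi; omega)
            _ = ((j : ℝ) + 1) * (C * s ^ m) := by simp
            _ ≤ _ := by
              have : (j : ℝ) ≤ k := by exact_mod_cast (by omega : j ≤ k)
              have := pow_nonneg hmem.1.le m
              gcongr
        have h2 : |z (j + 1) s| ≤ C * s ^ m := (H s hsτ).1 _ (by omega)
        have h3 : |a * z (j + 1) s| ≤ B * (C * s ^ m) := by
          rw [abs_mul, abs_of_pos (hα.trans_le ha)]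
          exact mul_le_mul haB h2 (abs_nonneg _) hB
        have h4 : |v| ≤ |v - a * z (j + 1) s| + |a * z (j + 1) s| := by
          simpa using abs_add_le (v - a * z (j + 1) s) (a * z (j + 1) s)
        have h5 := mul_le_mul_of_nonneg_left h1 hB
        have h6 : D * s ^ m ≤ D * (((m + 1 : ℕ) : ℝ) * s ^ m) := by
          have h7 := pow_nonneg hmem.1.le m
          have h8 : (1 : ℝ) ≤ ((m + 1 : ℕ) : ℝ) := by simp
          have := mul_le_mul_of_nonneg_right h8 h7
          rw [one_mul] at this
          exact mul_le_mul_of_nonneg_left this hD0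
        have h9 : D * s ^ m = B * (C * s ^ m) + B * ((k + 1) * (C * s ^ m)) := by rw [hD]; ring
        linarith
      have hj0 := h0 j (by omega)
      rw [abs_le]
      constructor
      · have := ((hpow D t).add (hsub t ht j (by omega))).le_of_ae_deriv_nonneg ht.1 (by
          filter_upwards [hder] with s hs hmem
          obtain ⟨v, hv, hd⟩ := hs hmem
          exact ⟨_, by linarith [(abs_le.1 hv).1], (hpowd D s).add hd⟩)
        simp [hj0] at this
        linarith
      · have := ((hpow D t).sub (hsub t ht j (by omega))).le_of_ae_deriv_nonneg ht.1 (by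
          filter_upwards [hder] with s hs hmem
          obtain ⟨v, hv, hd⟩ := hs hmem
          exact ⟨_, by linarith [(abs_le.1 hv).2], (hpowd D s).sub hd⟩)
        simp [hj0] at this
        linarith
    -- The lower terms in the derivative of `z p` are at most `N * s ^ (m + 1)`, one order smaller
    -- than the gain term `α * δ * s ^ m`. Up to time `σ` they consume at most half of it;
    -- integrating the other half gives the new constant.
    set N : ℝ := B * ((k + 1) * D) with hN
    have hN0 : 0 ≤ N := by positivity
    set σ : ℝ := min τ (α * δ / (2 * (N + 1))) with hσ
    have hσ0 : 0 < σ := by positivity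
    refine ⟨σ, α * δ / (2 * ((m + 1 : ℕ) : ℝ)), D, hσ0, (min_le_left _ _).trans hτT,
      by positivity, hD0, fun t ht => ?_⟩
    have htτ : t ∈ Set.Icc 0 τ := ⟨ht.1, ht.2.trans (min_le_left _ _)⟩
    refine ⟨hup t htτ, ?_⟩
    have := ((hsub t htτ p (by omega)).sub
      (hpow (α * δ / (2 * ((m + 1 : ℕ) : ℝ))) t)).le_of_ae_deriv_nonneg ht.1 (by
        filter_upwards [h] with s hs hmem
        have hsτ : s ∈ Set.Icc 0 τ := ⟨hmem.1.le, hmem.2.le.trans htτ.2⟩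
        obtain ⟨v, a, ha, haB, hv, hd⟩ := hs ⟨hmem.1, hmem.2.trans_le (htτ.2.trans hτT)⟩ p (by omega)
        refine ⟨_, ?_, hd.sub (hpowd _ s)⟩
        have hsm := pow_nonneg hmem.1.le m
        have h1 : ∑ i ∈ Finset.range (p + 1), |z i s| ≤ (k + 1) * (D * s ^ (m + 1)) := by
          calc _ ≤ ∑ i ∈ Finset.range (p + 1), D * s ^ (m + 1) := Finset.sum_le_sum fun i hi =>
                hup s hsτ i (by have := Finset.mem_range.1 hi; omega)
            _ = ((p : ℝ) + 1) * (D * s ^ (m + 1)) := by simp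
            _ ≤ _ := by
              have : (p : ℝ) ≤ k := by exact_mod_cast (by omega : p ≤ k)
              have := pow_nonneg hmem.1.le (m + 1)
              gcongr
        have h2 := mul_le_mul_of_nonneg_left h1 hB
        have h3 := (abs_le.1 hv).1
        have h4 := (H s hsτ).2
        have h5 : α * (δ * s ^ m) ≤ a * z (p + 1) s :=
          mul_le_mul ha h4 (by positivity) (hα.le.trans ha)
        have h6 : B * ((k + 1) * (D * s ^ (m + 1))) = (N * s) * s ^ m := by rw [hN]; ring
        have h7 : N * s ≤ α * δ / 2 := by
          have h8 : s ≤ α * δ / (2 * (N + 1)) := (hmem.2.le.trans ht.2).trans (min_le_right _ _)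
          rw [le_div_iff₀ (by positivity)] at h8
          have := hmem.1
          nlinarith
        have h9 := mul_le_mul_of_nonneg_right h7 hsm
        have h10 : α * δ / (2 * ((m + 1 : ℕ) : ℝ)) * (((m + 1 : ℕ) : ℝ) * s ^ m) =
            α * δ / 2 * s ^ m := by
          field_simp
        rw [h10]
        linarith)
    simp [h0 p (by omega)] at this
    push_cast
    linarith

/-- The output of a chain of integrators becomes positive if the first nonzero initial component is
positive. -/
theorem chain_pos {k : ℕ} {z : ℕ → ℝ → ℝ} {T α B : ℝ} (hT : 0 < T) (hα : 0 < α) (hB : 0 ≤ B)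
    (hz : ∀ j ≤ k, AbsolutelyContinuousOnInterval (z j) 0 T) (h0 : ∀ j < k, z j 0 = 0)
    (hk : 0 < z k 0)
    (h : ∀ᵐ t : ℝ, t ∈ Set.Ioo 0 T → ∀ i < k, ∃ v a, α ≤ a ∧ a ≤ B ∧
      |v - a * z (i + 1) t| ≤ B * ∑ j ∈ Finset.range (i + 1), |z j t| ∧ HasDerivAt (z i) v t) :
    ∃ τ > 0, ∀ t ∈ Set.Ioo 0 τ, 0 < z 0 t := by
  obtain ⟨τ, δ, C, hτ, -, hδ, -, H⟩ := chain_growth hT hα hB hz h0 hk h k le_rfl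
  refine ⟨τ, hτ, fun t ht => ?_⟩
  have h1 := (H t ⟨ht.1.le, ht.2.le⟩).2
  rw [Nat.sub_self] at h1
  have := ht.1
  exact lt_of_lt_of_le (by positivity) h1

/-! ### Absolute continuity under linear maps and time changes; linear equations -/

theorem AbsolutelyContinuousOnInterval.clm_comp {E F : Type*} [NormedAddCommGroup E]
    [NormedSpace ℝ E] [NormedAddCommGroup F] [NormedSpace ℝ F] (L : E →L[ℝ] F) {f : ℝ → E} {a b : ℝ}
    (hf : AbsolutelyContinuousOnInterval f a b) :
    AbsolutelyContinuousOnInterval (fun t => L (f t)) a b := by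
  refine squeeze_zero (fun t => Finset.sum_nonneg fun i _ => dist_nonneg) (fun t => ?_)
    (by simpa using Filter.Tendsto.const_mul ‖L‖ hf)
  rw [Finset.mul_sum]
  refine Finset.sum_le_sum fun i _ => ?_
  rw [dist_eq_norm, dist_eq_norm, ← map_sub]
  exact L.le_opNorm _

theorem AbsolutelyContinuousOnInterval.comp_add_const {E : Type*} [NormedAddCommGroup E]
    {f : ℝ → E} {a b : ℝ} (s : ℝ) (hf : AbsolutelyContinuousOnInterval f (a + s) (b + s)) :
    AbsolutelyContinuousOnInterval (fun t => f (t + s)) a b := by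
  rw [absolutelyContinuousOnInterval_iff] at hf ⊢
  intro ε hε
  obtain ⟨δ, hδ, H⟩ := hf ε hε
  refine ⟨δ, hδ, fun I hI hlen => ?_⟩
  refine H (I.1, fun i => ((I.2 i).1 + s, (I.2 i).2 + s)) ⟨fun i hi => ?_, ?_⟩ ?_
  · have := hI.1 i hi
    simp only [Set.mem_uIcc] at this ⊢
    grind
  · intro i hi j hj hij
    have := hI.2 hi hj hij
    simp only [Function.onFun, Set.uIoc, Set.Ioc_disjoint_Ioc, min_add_add_right,
      max_add_add_right] at this ⊢
    linarith
  · simpa using hlen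

theorem AbsolutelyContinuousOnInterval.comp_neg {E : Type*} [NormedAddCommGroup E]
    {f : ℝ → E} {a b : ℝ} (hf : AbsolutelyContinuousOnInterval f (-a) (-b)) :
    AbsolutelyContinuousOnInterval (fun t => f (-t)) a b := by
  rw [absolutelyContinuousOnInterval_iff] at hf ⊢
  intro ε hε
  obtain ⟨δ, hδ, H⟩ := hf ε hε
  refine ⟨δ, hδ, fun I hI hlen => ?_⟩
  refine H (I.1, fun i => (-(I.2 i).1, -(I.2 i).2)) ⟨fun i hi => ?_, ?_⟩ ?_
  · have := hI.1 i hi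
    simp only [Set.mem_uIcc] at this ⊢
    grind
  · intro i hi j hj hij
    have := hI.2 hi hj hij
    simp only [Function.onFun, Set.uIoc, Set.Ioc_disjoint_Ioc, min_neg_neg, max_neg_neg] at this ⊢
    linarith
  · simpa [dist_neg_neg] using hlen

/-- The dot product with a fixed vector, as a continuous linear functional. -/
noncomputable def dotProductCLM {n : ℕ} (p : Fin n → ℝ) : (Fin n → ℝ) →L[ℝ] ℝ :=
  ∑ i, p i • ContinuousLinearMap.proj i

@[simp]
theorem dotProductCLM_apply {n : ℕ} (p x : Fin n → ℝ) : dotProductCLM p x = p ⬝ᵥ x := by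
  simp [dotProductCLM, dotProduct]

theorem HasDerivAt.const_dotProduct {n : ℕ} (p : Fin n → ℝ) {x : ℝ → Fin n → ℝ} {v : Fin n → ℝ}
    {t : ℝ} (hx : HasDerivAt x v t) : HasDerivAt (fun s => p ⬝ᵥ x s) (p ⬝ᵥ v) t := by
  have := (dotProductCLM p).hasFDerivAt.comp_hasDerivAt t hx
  simpa [Function.comp_def] using this

theorem AbsolutelyContinuousOnInterval.const_dotProduct {n : ℕ} (p : Fin n → ℝ)
    {x : ℝ → Fin n → ℝ} {a b : ℝ} (hx : AbsolutelyContinuousOnInterval x a b) :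
    AbsolutelyContinuousOnInterval (fun s => p ⬝ᵥ x s) a b := by
  simpa using hx.clm_comp (dotProductCLM p)

/-- Uniqueness of absolutely continuous solutions of a linear differential equation. -/
theorem eqOn_of_ae_hasDerivAt_mulVec {n : ℕ} (A : Matrix (Fin n) (Fin n) ℝ) {x y : ℝ → Fin n → ℝ}
    {τ : ℝ} (hx : ∀ a b, AbsolutelyContinuousOnInterval x a b)
    (hy : ∀ a b, AbsolutelyContinuousOnInterval y a b) (h0 : x 0 = y 0)
    (hxd : ∀ᵐ t : ℝ, t ∈ Set.Ioo 0 τ → HasDerivAt x (A *ᵥ x t) t)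
    (hyd : ∀ᵐ t : ℝ, t ∈ Set.Ioo 0 τ → HasDerivAt y (A *ᵥ y t) t) :
    ∀ t ∈ Set.Ico 0 τ, x t = y t := by
  intro t ht
  have hcoord : ∀ {w : ℝ → Fin n → ℝ}, (∀ a b, AbsolutelyContinuousOnInterval w a b) →
      ∀ i, AbsolutelyContinuousOnInterval (fun s => w s i) 0 t := fun hw i => by
    simpa using (hw 0 t).const_dotProduct (Pi.single i 1)
  have key := eq_zero_of_ae_abs_deriv_le (Finset.univ : Finset (Fin n))
    (z := fun i s => x s i - y s i) (T := t) (B := ∑ i, ∑ j, |A i j|) ht.1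
    (Finset.sum_nonneg fun _ _ => Finset.sum_nonneg fun _ _ => abs_nonneg _)
    (fun i _ => (hcoord hx i).sub (hcoord hy i))
    (fun i _ => by simp [h0]) (by
      filter_upwards [hxd, hyd] with s hs hs' hmem i _
      have hmem' : s ∈ Set.Ioo 0 τ := ⟨hmem.1, hmem.2.trans ht.2⟩
      refine ⟨_, ?_, (hasDerivAt_pi.1 (hs hmem') i).sub (hasDerivAt_pi.1 (hs' hmem') i)⟩
      have h1 : (A *ᵥ x s) i - (A *ᵥ y s) i = ∑ j, A i j * (x s j - y s j) := by
        simp [mulVec, dotProduct, mul_sub, Finset.sum_sub_distrib]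
      rw [h1, Finset.mul_sum]
      refine (Finset.abs_sum_le_sum_abs _ _).trans (Finset.sum_le_sum fun j _ => ?_)
      rw [abs_mul]
      refine mul_le_mul_of_nonneg_right ?_ (abs_nonneg _)
      exact (Finset.single_le_sum (f := fun j => |A i j|) (fun _ _ => abs_nonneg _)
        (Finset.mem_univ j)).trans (Finset.single_le_sum (f := fun i => ∑ j, |A i j|)
          (fun _ _ => Finset.sum_nonneg fun _ _ => abs_nonneg _) (Finset.mem_univ i)))
  funext i
  exact sub_eq_zero.1 (key i (Finset.mem_univ i))

/-! ### The set-valued map and its symmetries -/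

section filippovMap

variable {n : ℕ} {A₁ A₂ : Matrix (Fin n) (Fin n) ℝ} {c ξ : Fin n → ℝ} {x y : ℝ → Fin n → ℝ}

theorem filippovMap_of_neg {x : Fin n → ℝ} (hx : c ⬝ᵥ x < 0) :
    filippovMap A₁ A₂ 0 0 c 0 x = {A₁ *ᵥ x} := by
  simp [filippovMap, hx]

theorem filippovMap_of_zero {x : Fin n → ℝ} (hx : c ⬝ᵥ x = 0) :
    filippovMap A₁ A₂ 0 0 c 0 x = segment ℝ (A₁ *ᵥ x) (A₂ *ᵥ x) := by
  simp [filippovMap, hx, convexHull_pair]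

theorem filippovMap_of_pos {x : Fin n → ℝ} (hx : 0 < c ⬝ᵥ x) :
    filippovMap A₁ A₂ 0 0 c 0 x = {A₂ *ᵥ x} := by
  simp [filippovMap, hx.not_gt, hx.ne']

/-- A relaxation that forgets the side of the hyperplane. The chain estimates need nothing more
about a solution. -/
theorem filippovMap_subset_segment (x : Fin n → ℝ) :
    filippovMap A₁ A₂ 0 0 c 0 x ⊆ segment ℝ (A₁ *ᵥ x) (A₂ *ᵥ x) := by
  rcases lt_trichotomy (c ⬝ᵥ x) 0 with hx | hx | hx
  · rw [filippovMap_of_neg hx]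
    exact Set.singleton_subset_iff.2 (left_mem_segment _ _ _)
  · rw [filippovMap_of_zero hx]
  · rw [filippovMap_of_pos hx]
    exact Set.singleton_subset_iff.2 (right_mem_segment _ _ _)

/-- Time reversal negates both modes but leaves the switching functional alone, so backward
questions become forward ones for `-A₁` and `-A₂`. -/
theorem filippovMap_neg {x v : Fin n → ℝ} (hv : v ∈ filippovMap A₁ A₂ 0 0 c 0 x) :
    -v ∈ filippovMap (-A₁) (-A₂) 0 0 c 0 x := by
  rcases lt_trichotomy (c ⬝ᵥ x) 0 with hx | hx | hx
  · rw [filippovMap_of_neg hx] at hv ⊢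
    simp_all [neg_mulVec]
  · rw [filippovMap_of_zero hx] at hv ⊢
    obtain ⟨a, b, ha, hb, hab, rfl⟩ := hv
    exact ⟨a, b, ha, hb, hab, by simp [neg_mulVec, add_comm]⟩
  · rw [filippovMap_of_pos hx] at hv ⊢
    simp_all [neg_mulVec]

theorem IsFilippovSolution.translate (hx : IsFilippovSolution A₁ A₂ 0 0 c 0 ξ x) (s : ℝ) :
    IsFilippovSolution A₁ A₂ 0 0 c 0 (x s) (fun t => x (t + s)) := by
  refine ⟨fun a b => (hx.1 _ _).comp_add_const s, by simp, ?_⟩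
  have := (measurePreserving_add_right (volume : Measure ℝ) s).quasiMeasurePreserving.ae hx.2.2
  filter_upwards [this] with t ht
  obtain ⟨v, hv, hd⟩ := ht
  exact ⟨v, hv, hd.comp_add_const t s⟩

theorem IsFilippovSolution.reverse (hx : IsFilippovSolution A₁ A₂ 0 0 c 0 ξ x) :
    IsFilippovSolution (-A₁) (-A₂) 0 0 c 0 ξ (fun t => x (-t)) := by
  refine ⟨fun a b => (hx.1 _ _).comp_neg, by simpa using hx.2.1, ?_⟩
  have := (Measure.measurePreserving_neg (volume : Measure ℝ)).quasiMeasurePreserving.ae hx.2.2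
  filter_upwards [this] with t ht
  obtain ⟨v, hv, hd⟩ := ht
  refine ⟨-v, filippovMap_neg hv, ?_⟩
  have := hd.scomp t (hasDerivAt_neg t)
  simpa [Function.comp_def] using this

theorem IsFilippovSolution.continuous (hx : IsFilippovSolution A₁ A₂ 0 0 c 0 ξ x) :
    Continuous x := by
  refine continuous_iff_continuousAt.2 fun t => ?_
  refine (hx.1 (t - 1) (t + 1)).continuousOn.continuousAt ?_
  rw [Set.uIcc_of_le (by linarith)]
  exact Icc_mem_nhds (by linarith) (by linarith)

end filippovMap

/-! ### Integrator chains imply uniqueness -/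

/-- Linear functionals `r 0, …, r h` in which both modes have the form of a chain of integrators up
to a lower triangular part and positive gains, and outside of which the modes agree. -/
structure IsIntegratorChain {n : ℕ} (A₁ A₂ : Matrix (Fin n) (Fin n) ℝ) (h : ℕ) (r : ℕ → Fin n → ℝ) :
    Prop where
  step₁ : ∀ i < h, ∃ a > (0 : ℝ), r i ᵥ* A₁ - a • r (i + 1) ∈ Submodule.span ℝ (r '' Set.Iic i)
  step₂ : ∀ i < h, ∃ a > (0 : ℝ), r i ᵥ* A₂ - a • r (i + 1) ∈ Submodule.span ℝ (r '' Set.Iic i)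
  last₁ : r h ᵥ* A₁ ∈ Submodule.span ℝ (r '' Set.Iic h)
  last₂ : r h ᵥ* A₂ ∈ Submodule.span ℝ (r '' Set.Iic h)
  agree : ∀ x, (∀ i ≤ h, r i ⬝ᵥ x = 0) → A₁ *ᵥ x = A₂ *ᵥ x

theorem exists_abs_dotProduct_le_of_mem_span {n : ℕ} {r : ℕ → Fin n → ℝ} {i : ℕ} {p : Fin n → ℝ}
    (hp : p ∈ Submodule.span ℝ (r '' Set.Iic i)) :
    ∃ B ≥ 0, ∀ x, |p ⬝ᵥ x| ≤ B * ∑ j ∈ Finset.range (i + 1), |r j ⬝ᵥ x| := by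
  induction hp using Submodule.span_induction with
  | mem p hp =>
    obtain ⟨j, hj, rfl⟩ := hp
    refine ⟨1, zero_le_one, fun x => ?_⟩
    rw [one_mul]
    exact Finset.single_le_sum (f := fun j => |r j ⬝ᵥ x|) (fun _ _ => abs_nonneg _)
      (Finset.mem_range.2 (Nat.lt_succ_of_le hj))
  | zero => exact ⟨0, le_rfl, fun x => by simp⟩
  | add p q _ _ hp hq =>
    obtain ⟨B, hB, hp⟩ := hp
    obtain ⟨C, hC, hq⟩ := hq
    refine ⟨B + C, add_nonneg hB hC, fun x => ?_⟩
    rw [add_dotProduct, add_mul]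
    exact (abs_add_le _ _).trans (add_le_add (hp x) (hq x))
  | smul a p _ hp =>
    obtain ⟨B, hB, hp⟩ := hp
    refine ⟨|a| * B, by positivity, fun x => ?_⟩
    rw [smul_dotProduct, smul_eq_mul, abs_mul, mul_assoc]
    exact mul_le_mul_of_nonneg_left (hp x) (abs_nonneg a)

theorem exists_uniform_bounds {P : ℕ → ℝ → ℝ → Prop} {m : ℕ}
    (mono : ∀ i α β B C, P i α B → β ≤ α → B ≤ C → P i β C)
    (h : ∀ i < m, ∃ α > 0, ∃ B ≥ 0, P i α B) : ∃ α > 0, ∃ B ≥ 0, ∀ i < m, P i α B := by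
  induction m with
  | zero => exact ⟨1, one_pos, 0, le_rfl, fun i hi => absurd hi (by omega)⟩
  | succ m ih =>
    obtain ⟨α, hα, B, hB, H⟩ := ih fun i hi => h i (by omega)
    obtain ⟨β, hβ, C, hC, H'⟩ := h m (by omega)
    refine ⟨min α β, lt_min hα hβ, max B C, le_max_of_le_left hB, fun i hi => ?_⟩
    rcases Nat.lt_succ_iff_lt_or_eq.1 hi with hi | rfl
    · exact mono _ _ _ _ _ (H i hi) (min_le_left _ _) (le_max_left _ _)
    · exact mono _ _ _ _ _ H' (min_le_right _ _) (le_max_right _ _)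

namespace IsIntegratorChain

variable {n h : ℕ} {A₁ A₂ : Matrix (Fin n) (Fin n) ℝ} {r : ℕ → Fin n → ℝ} {c ξ : Fin n → ℝ}
  {x y : ℝ → Fin n → ℝ}

/-- A convex combination of the modes has the same convex combination of the two gains, which lies
between their minimum and their sum, and of the two lower triangular remainders. The gain varies
with the state and the selection; only its bounds matter. -/
theorem exists_gain_bounds (H : IsIntegratorChain A₁ A₂ h r) : ∃ α > 0, ∃ B ≥ 0, ∀ i < h, ∀ x,
    ∀ v ∈ segment ℝ (A₁ *ᵥ x) (A₂ *ᵥ x), ∃ a, α ≤ a ∧ a ≤ B ∧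
      |r i ⬝ᵥ v - a * (r (i + 1) ⬝ᵥ x)| ≤ B * ∑ j ∈ Finset.range (i + 1), |r j ⬝ᵥ x| := by
  refine exists_uniform_bounds ?_ ?_
  · intro i α β B C hP hβ hC x v hv
    obtain ⟨a, h1, h2, h3⟩ := hP x v hv
    exact ⟨a, hβ.trans h1, h2.trans hC, h3.trans
      (mul_le_mul_of_nonneg_right hC (Finset.sum_nonneg fun _ _ => abs_nonneg _))⟩
  · intro i hi
    obtain ⟨a₁, ha₁, h₁⟩ := H.step₁ i hi
    obtain ⟨a₂, ha₂, h₂⟩ := H.step₂ i hi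
    obtain ⟨B₁, hB₁, h₁⟩ := exists_abs_dotProduct_le_of_mem_span h₁
    obtain ⟨B₂, hB₂, h₂⟩ := exists_abs_dotProduct_le_of_mem_span h₂
    refine ⟨min a₁ a₂, lt_min ha₁ ha₂, a₁ + a₂ + B₁ + B₂, by positivity, ?_⟩
    rintro x _ ⟨s, t, hs, ht, hst, rfl⟩
    have hs1 : s ≤ 1 := by linarith
    have ht1 : t ≤ 1 := by linarith
    refine ⟨s * a₁ + t * a₂, ?_, ?_, ?_⟩
    · have h3 := mul_le_mul_of_nonneg_left (min_le_left a₁ a₂) hs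
      have h4 := mul_le_mul_of_nonneg_left (min_le_right a₁ a₂) ht
      calc min a₁ a₂ = s * min a₁ a₂ + t * min a₁ a₂ := by rw [← add_mul, hst, one_mul]
        _ ≤ _ := add_le_add h3 h4
    · nlinarith
    · have h1 := h₁ x
      have h2 := h₂ x
      set S := ∑ j ∈ Finset.range (i + 1), |r j ⬝ᵥ x|
      have hS : 0 ≤ S := Finset.sum_nonneg fun _ _ => abs_nonneg _
      have h5 : r i ⬝ᵥ (s • A₁ *ᵥ x + t • A₂ *ᵥ x) - (s * a₁ + t * a₂) * (r (i + 1) ⬝ᵥ x) =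
          s * ((r i ᵥ* A₁ - a₁ • r (i + 1)) ⬝ᵥ x) + t * ((r i ᵥ* A₂ - a₂ • r (i + 1)) ⬝ᵥ x) := by
        simp only [dotProduct_add, dotProduct_smul, dotProduct_mulVec, sub_dotProduct,
          smul_dotProduct, smul_eq_mul]
        ring
      rw [h5]
      refine (abs_add_le _ _).trans ?_
      rw [abs_mul, abs_mul, abs_of_nonneg hs, abs_of_nonneg ht]
      have h6 := mul_le_mul hs1 h1 (abs_nonneg _) zero_le_one
      have h7 := mul_le_mul ht1 h2 (abs_nonneg _) zero_le_one
      have : 0 ≤ (a₁ + a₂) * S := by positivity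
      linarith

theorem vecMul_mem (H : IsIntegratorChain A₁ A₂ h r) {i : ℕ} (hi : i ≤ h) :
    r i ᵥ* A₁ ∈ Submodule.span ℝ (r '' Set.Iic h) ∧
      r i ᵥ* A₂ ∈ Submodule.span ℝ (r '' Set.Iic h) := by
  rcases hi.lt_or_eq with hi | rfl
  · have hle : Submodule.span ℝ (r '' Set.Iic i) ≤ Submodule.span ℝ (r '' Set.Iic h) :=
      Submodule.span_mono (Set.image_mono (Set.Iic_subset_Iic.2 hi.le))
    have hmem : r (i + 1) ∈ Submodule.span ℝ (r '' Set.Iic h) :=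
      Submodule.subset_span ⟨i + 1, hi, rfl⟩
    obtain ⟨a₁, -, h₁⟩ := H.step₁ i hi
    obtain ⟨a₂, -, h₂⟩ := H.step₂ i hi
    constructor
    · simpa using Submodule.add_mem _ (hle h₁) (Submodule.smul_mem _ a₁ hmem)
    · simpa using Submodule.add_mem _ (hle h₂) (Submodule.smul_mem _ a₂ hmem)
  · exact ⟨H.last₁, H.last₂⟩

/-- The span of the whole chain is invariant under both modes, so the chain components satisfy a
closed system of inequalities, ready for Gronwall. -/
theorem exists_bound (H : IsIntegratorChain A₁ A₂ h r) : ∃ B ≥ 0, ∀ i ≤ h, ∀ x,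
    ∀ v ∈ segment ℝ (A₁ *ᵥ x) (A₂ *ᵥ x),
      |r i ⬝ᵥ v| ≤ B * ∑ j ∈ Finset.range (h + 1), |r j ⬝ᵥ x| := by
  obtain ⟨-, -, B, hB, key⟩ := exists_uniform_bounds (m := h + 1) (P := fun i _ B => ∀ x,
    ∀ v ∈ segment ℝ (A₁ *ᵥ x) (A₂ *ᵥ x),
      |r i ⬝ᵥ v| ≤ B * ∑ j ∈ Finset.range (h + 1), |r j ⬝ᵥ x|) (by
    intro i α β B C hP hβ hC x v hv
    exact (hP x v hv).trans
      (mul_le_mul_of_nonneg_right hC (Finset.sum_nonneg fun _ _ => abs_nonneg _))) (by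
    intro i hi
    obtain ⟨h₁, h₂⟩ := H.vecMul_mem (Nat.lt_succ_iff.1 hi)
    obtain ⟨B₁, hB₁, h₁⟩ := exists_abs_dotProduct_le_of_mem_span h₁
    obtain ⟨B₂, hB₂, h₂⟩ := exists_abs_dotProduct_le_of_mem_span h₂
    refine ⟨1, one_pos, B₁ + B₂, by positivity, ?_⟩
    rintro x _ ⟨s, t, hs, ht, hst, rfl⟩
    have h1 := h₁ x
    have h2 := h₂ x
    simp only [dotProduct_add, dotProduct_smul, dotProduct_mulVec, smul_eq_mul]
    refine (abs_add_le _ _).trans ?_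
    rw [abs_mul, abs_mul, abs_of_nonneg hs, abs_of_nonneg ht]
    have h6 := mul_le_mul (by linarith : s ≤ 1) h1 (abs_nonneg _) zero_le_one
    have h7 := mul_le_mul (by linarith : t ≤ 1) h2 (abs_nonneg _) zero_le_one
    linarith)
  exact ⟨B, hB, fun i hi => key i (Nat.lt_succ_of_le hi)⟩

theorem output_pos (H : IsIntegratorChain A₁ A₂ h r) (hx : ∀ a b, AbsolutelyContinuousOnInterval x a b)
    (hd : ∀ᵐ t : ℝ, ∃ v ∈ segment ℝ (A₁ *ᵥ x t) (A₂ *ᵥ x t), HasDerivAt x v t) {k : ℕ}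
    (hk : k ≤ h) (h0 : ∀ j < k, r j ⬝ᵥ x 0 = 0) (hpos : 0 < r k ⬝ᵥ x 0) :
    ∃ τ > 0, ∀ t ∈ Set.Ioo 0 τ, 0 < r 0 ⬝ᵥ x t := by
  obtain ⟨α, hα, B, hB, key⟩ := H.exists_gain_bounds
  refine chain_pos (z := fun i t => r i ⬝ᵥ x t) one_pos hα hB
    (fun j _ => (hx 0 1).const_dotProduct (r j)) h0 hpos ?_
  filter_upwards [hd] with t ht _ i hi
  obtain ⟨v, hv, hd⟩ := ht
  obtain ⟨a, h1, h2, h3⟩ := key i (by omega) (x t) v hv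
  exact ⟨_, a, h1, h2, h3, hd.const_dotProduct (r i)⟩

/-- The relaxed inclusion into the segment is odd in `x`, so the positive case applies to `-x`. The
Filippov map itself lacks this symmetry, since `-x` lies on the other side of the hyperplane. -/
theorem output_neg (H : IsIntegratorChain A₁ A₂ h r) (hx : ∀ a b, AbsolutelyContinuousOnInterval x a b)
    (hd : ∀ᵐ t : ℝ, ∃ v ∈ segment ℝ (A₁ *ᵥ x t) (A₂ *ᵥ x t), HasDerivAt x v t) {k : ℕ}
    (hk : k ≤ h) (h0 : ∀ j < k, r j ⬝ᵥ x 0 = 0) (hneg : r k ⬝ᵥ x 0 < 0) :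
    ∃ τ > 0, ∀ t ∈ Set.Ioo 0 τ, r 0 ⬝ᵥ x t < 0 := by
  obtain ⟨τ, hτ, h1⟩ := H.output_pos (x := -x) (k := k) (fun a b => (hx a b).neg) (by
    filter_upwards [hd] with t ht
    obtain ⟨_, ⟨a, b, ha, hb, hab, rfl⟩, hd⟩ := ht
    exact ⟨_, ⟨a, b, ha, hb, hab, by simp [mulVec_neg, add_comm]⟩, hd.neg⟩) hk
    (fun j hj => by simp [h0 j hj]) (by simpa using hneg)
  exact ⟨τ, hτ, fun t ht => by simpa using h1 t ht⟩

theorem output_zero (H : IsIntegratorChain A₁ A₂ h r) (hx : ∀ a b, AbsolutelyContinuousOnInterval x a b)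
    (hd : ∀ᵐ t : ℝ, ∃ v ∈ segment ℝ (A₁ *ᵥ x t) (A₂ *ᵥ x t), HasDerivAt x v t)
    (h0 : ∀ j ≤ h, r j ⬝ᵥ x 0 = 0) : ∀ t ≥ 0, ∀ j ≤ h, r j ⬝ᵥ x t = 0 := by
  intro t ht j hj
  obtain ⟨B, hB, key⟩ := H.exists_bound
  refine eq_zero_of_ae_abs_deriv_le (Finset.range (h + 1)) (z := fun i t => r i ⬝ᵥ x t) ht hB
    (fun i _ => (hx 0 t).const_dotProduct (r i))
    (fun i hi => h0 i (Nat.lt_succ_iff.1 (Finset.mem_range.1 hi))) ?_ j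
    (Finset.mem_range.2 (Nat.lt_succ_of_le hj))
  filter_upwards [hd] with s hs _ i hi
  obtain ⟨v, hv, hd⟩ := hs
  exact ⟨_, key i (Nat.lt_succ_iff.1 (Finset.mem_range.1 hi)) (x s) v hv, hd.const_dotProduct _⟩

/-- The first nonvanishing chain component at `ξ` fixes the sign of the output of every solution
from `ξ`, hence the active mode. If there is none, the solutions remain where the modes agree. In
each case both solutions solve the same linear equation near `0`. -/
theorem right_unique (H : IsIntegratorChain A₁ A₂ h r) (hc : r 0 = c)
    (hx : IsFilippovSolution A₁ A₂ 0 0 c 0 ξ x) (hy : IsFilippovSolution A₁ A₂ 0 0 c 0 ξ y) :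
    ∃ ε > 0, ∀ t ∈ Set.Ico (0 : ℝ) ε, x t = y t := by
  have seg : ∀ {x : ℝ → Fin n → ℝ}, IsFilippovSolution A₁ A₂ 0 0 c 0 ξ x →
      ∀ᵐ t : ℝ, ∃ v ∈ segment ℝ (A₁ *ᵥ x t) (A₂ *ᵥ x t), HasDerivAt x v t := fun hx => by
    filter_upwards [hx.2.2] with t ht
    obtain ⟨v, hv, hd⟩ := ht
    exact ⟨v, filippovMap_subset_segment _ hv, hd⟩
  have hxy : x 0 = y 0 := hx.2.1.trans hy.2.1.symm
  by_cases hzero : ∀ j ≤ h, r j ⬝ᵥ ξ = 0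
  · have hlin : ∀ {w : ℝ → Fin n → ℝ}, IsFilippovSolution A₁ A₂ 0 0 c 0 ξ w →
        ∀ᵐ t : ℝ, t ∈ Set.Ioo 0 1 → HasDerivAt w (A₁ *ᵥ w t) t := fun hw => by
      have h0 := H.output_zero hw.1 (seg hw) (by rwa [hw.2.1])
      filter_upwards [seg hw] with t ht hmem
      obtain ⟨v, hv, hd⟩ := ht
      rw [← H.agree _ (h0 t hmem.1.le), segment_same] at hv
      rwa [Set.mem_singleton_iff.1 hv] at hd
    exact ⟨1, one_pos, eqOn_of_ae_hasDerivAt_mulVec A₁ hx.1 hy.1 hxy (hlin hx) (hlin hy)⟩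
  · classical
    push Not at hzero
    have hex := hzero
    set k := Nat.find hex with hk
    obtain ⟨hkh, hkne⟩ := Nat.find_spec hex
    have hlt : ∀ j < k, r j ⬝ᵥ ξ = 0 := fun j hj => by
      by_contra hne
      exact Nat.find_min hex hj ⟨hj.le.trans hkh, hne⟩
    rcases lt_or_gt_of_ne hkne with hneg | hpos
    · obtain ⟨τ, hτ, hτx⟩ := H.output_neg hx.1 (seg hx) hkh (by rwa [hx.2.1]) (by rwa [hx.2.1])
      obtain ⟨σ, hσ, hσy⟩ := H.output_neg hy.1 (seg hy) hkh (by rwa [hy.2.1]) (by rwa [hy.2.1])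
      rw [hc] at hτx hσy
      refine ⟨min τ σ, lt_min hτ hσ, eqOn_of_ae_hasDerivAt_mulVec A₁ hx.1 hy.1 hxy ?_ ?_⟩
      · filter_upwards [hx.2.2] with t ht hmem
        obtain ⟨v, hv, hd⟩ := ht
        rw [filippovMap_of_neg (hτx t ⟨hmem.1, hmem.2.trans_le (min_le_left _ _)⟩)] at hv
        rwa [Set.mem_singleton_iff.1 hv] at hd
      · filter_upwards [hy.2.2] with t ht hmem
        obtain ⟨v, hv, hd⟩ := ht
        rw [filippovMap_of_neg (hσy t ⟨hmem.1, hmem.2.trans_le (min_le_right _ _)⟩)] at hv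
        rwa [Set.mem_singleton_iff.1 hv] at hd
    · obtain ⟨τ, hτ, hτx⟩ := H.output_pos hx.1 (seg hx) hkh (by rwa [hx.2.1]) (by rwa [hx.2.1])
      obtain ⟨σ, hσ, hσy⟩ := H.output_pos hy.1 (seg hy) hkh (by rwa [hy.2.1]) (by rwa [hy.2.1])
      rw [hc] at hτx hσy
      refine ⟨min τ σ, lt_min hτ hσ, eqOn_of_ae_hasDerivAt_mulVec A₂ hx.1 hy.1 hxy ?_ ?_⟩
      · filter_upwards [hx.2.2] with t ht hmem
        obtain ⟨v, hv, hd⟩ := ht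
        rw [filippovMap_of_pos (hτx t ⟨hmem.1, hmem.2.trans_le (min_le_left _ _)⟩)] at hv
        rwa [Set.mem_singleton_iff.1 hv] at hd
      · filter_upwards [hy.2.2] with t ht hmem
        obtain ⟨v, hv, hd⟩ := ht
        rw [filippovMap_of_pos (hσy t ⟨hmem.1, hmem.2.trans_le (min_le_right _ _)⟩)] at hv
        rwa [Set.mem_singleton_iff.1 hv] at hd

/-- Continuous induction: the coincidence set is closed, and right uniqueness of the solutions
translated to a time `s` in it extends it beyond `s`. -/
theorem forward_unique (H : IsIntegratorChain A₁ A₂ h r) (hc : r 0 = c)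
    (hx : IsFilippovSolution A₁ A₂ 0 0 c 0 ξ x) (hy : IsFilippovSolution A₁ A₂ 0 0 c 0 ξ y) {t : ℝ}
    (ht : 0 ≤ t) : x t = y t := by
  have hclosed : IsClosed {s | x s = y s} := isClosed_eq hx.continuous hy.continuous
  refine IsClosed.Icc_subset_of_forall_mem_nhdsWithin (a := 0) (b := t) (s := {s | x s = y s})
    (hclosed.inter isClosed_Icc) (hx.2.1.trans hy.2.1.symm) ?_ ⟨ht, le_rfl⟩
  rintro s ⟨hs, -⟩
  have hs' : x s = y s := hs
  obtain ⟨ε, hε, heq⟩ := H.right_unique hc (hx.translate s) (hs' ▸ hy.translate s)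
  refine Filter.mem_of_superset (Ioo_mem_nhdsGT (lt_add_of_pos_right s hε)) fun u hu => ?_
  have := heq (u - s) ⟨by linarith [hu.1], by linarith [hu.2]⟩
  simpa using this

/-- Negating the modes would make the gains negative; the alternating signs restore them and leave
`r 0` unchanged. -/
theorem reverse (H : IsIntegratorChain A₁ A₂ h r) : IsIntegratorChain (-A₁) (-A₂) h (fun i => (-1 : ℝ) ^ i • r i) := by
  have hspan : ∀ i, Submodule.span ℝ (r '' Set.Iic i) ≤
      Submodule.span ℝ ((fun i => (-1 : ℝ) ^ i • r i) '' Set.Iic i) := by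
    intro i
    rw [Submodule.span_le]
    rintro _ ⟨j, hj, rfl⟩
    have h1 : r j = (-1 : ℝ) ^ j • ((-1 : ℝ) ^ j • r j) := by
      rw [smul_smul, ← mul_pow]
      simp
    rw [h1]
    exact Submodule.smul_mem _ _ (Submodule.subset_span ⟨j, hj, rfl⟩)
  have hstep : ∀ (A : Matrix (Fin n) (Fin n) ℝ) (i : ℕ),
      (∃ a > (0 : ℝ), r i ᵥ* A - a • r (i + 1) ∈ Submodule.span ℝ (r '' Set.Iic i)) →
      ∃ a > (0 : ℝ), ((-1 : ℝ) ^ i • r i) ᵥ* (-A) - a • ((-1 : ℝ) ^ (i + 1) • r (i + 1)) ∈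
        Submodule.span ℝ ((fun i => (-1 : ℝ) ^ i • r i) '' Set.Iic i) := by
    rintro A i ⟨a, ha, hmem⟩
    refine ⟨a, ha, ?_⟩
    have h1 : ((-1 : ℝ) ^ i • r i) ᵥ* (-A) - a • ((-1 : ℝ) ^ (i + 1) • r (i + 1)) =
        (-1 : ℝ) ^ (i + 1) • (r i ᵥ* A - a • r (i + 1)) := by
      rw [vecMul_neg, smul_vecMul, pow_succ]
      module
    rw [h1]
    exact Submodule.smul_mem _ _ (hspan i hmem)
  have hlast : ∀ A : Matrix (Fin n) (Fin n) ℝ, r h ᵥ* A ∈ Submodule.span ℝ (r '' Set.Iic h) →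
      ((-1 : ℝ) ^ h • r h) ᵥ* (-A) ∈
        Submodule.span ℝ ((fun i => (-1 : ℝ) ^ i • r i) '' Set.Iic h) := by
    intro A hmem
    rw [vecMul_neg, smul_vecMul]
    exact Submodule.neg_mem _ (Submodule.smul_mem _ _ (hspan h hmem))
  refine ⟨fun i hi => hstep A₁ i (H.step₁ i hi), fun i hi => hstep A₂ i (H.step₂ i hi),
    hlast A₁ H.last₁, hlast A₂ H.last₂, fun x hx => ?_⟩
  rw [neg_mulVec, neg_mulVec, H.agree x fun i hi => ?_]
  have := hx i hi
  simpa [smul_dotProduct] using this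

/-- Filippov solutions are unique on the whole time axis in the presence of a chain starting with
the switching functional. -/
theorem unique (H : IsIntegratorChain A₁ A₂ h r) (hc : r 0 = c)
    (hx : IsFilippovSolution A₁ A₂ 0 0 c 0 ξ x) (hy : IsFilippovSolution A₁ A₂ 0 0 c 0 ξ y) (t : ℝ) :
    x t = y t := by
  rcases le_total 0 t with ht | ht
  · exact H.forward_unique hc hx hy ht
  · have := H.reverse.forward_unique (c := c) (by simpa using hc) hx.reverse hy.reverse
      (neg_nonneg.2 ht)
    simpa using this

end IsIntegratorChain

/-! ### Existence of forward solutions by Euler schemes -/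

/-- The explicit Euler scheme with step size `δ` for `x' = g x`. -/
noncomputable def eulerSeq {E : Type*} [NormedAddCommGroup E] [NormedSpace ℝ E] (g : E → E) (δ : ℝ)
    (ξ : E) : ℕ → E
  | 0 => ξ
  | k + 1 => eulerSeq g δ ξ k + δ • g (eulerSeq g δ ξ k)

section Euler

variable {E : Type*} [NormedAddCommGroup E] [NormedSpace ℝ E] {g : E → E} {δ L : ℝ} {ξ : E}

theorem norm_eulerSeq_le (hδ : 0 ≤ δ) (hg : ∀ y, ‖g y‖ ≤ L * ‖y‖) (k : ℕ) :
    ‖eulerSeq g δ ξ k‖ ≤ Real.exp (L * (δ * k)) * ‖ξ‖ := by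
  induction k with
  | zero => simp [eulerSeq]
  | succ k ih =>
    have h1 : ‖eulerSeq g δ ξ (k + 1)‖ ≤ (L * δ + 1) * ‖eulerSeq g δ ξ k‖ := by
      refine (norm_add_le _ _).trans ?_
      rw [norm_smul, Real.norm_of_nonneg hδ]
      have := mul_le_mul_of_nonneg_left (hg (eulerSeq g δ ξ k)) hδ
      linarith
    have h2 := mul_le_mul_of_nonneg_right (Real.add_one_le_exp (L * δ))
      (norm_nonneg (eulerSeq g δ ξ k))
    have h3 := mul_le_mul_of_nonneg_left ih (Real.exp_pos (L * δ)).le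
    calc _ ≤ _ := h1.trans (h2.trans h3)
      _ = Real.exp (L * δ + L * (δ * k)) * ‖ξ‖ := by rw [Real.exp_add]; ring
      _ = _ := by push_cast; ring_nf

theorem norm_eulerSeq_le_of_le (hδ : 0 ≤ δ) (hL : 0 ≤ L) (hg : ∀ y, ‖g y‖ ≤ L * ‖y‖) {k : ℕ} {T : ℝ}
    (hk : δ * k ≤ T) : ‖eulerSeq g δ ξ k‖ ≤ Real.exp (L * T) * ‖ξ‖ :=
  (norm_eulerSeq_le hδ hg k).trans (by gcongr)

theorem norm_eulerSeq_add_sub_le (hδ : 0 ≤ δ) (hL : 0 ≤ L) (hg : ∀ y, ‖g y‖ ≤ L * ‖y‖) {T : ℝ}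
    (k m : ℕ) (hk : δ * (k + m : ℕ) ≤ T) :
    ‖eulerSeq g δ ξ (k + m) - eulerSeq g δ ξ k‖ ≤ L * (Real.exp (L * T) * ‖ξ‖) * (δ * m) := by
  induction m with
  | zero => simp
  | succ m ih =>
    have hk' : δ * (k + m : ℕ) ≤ T := le_trans (by gcongr; omega) hk
    have h1 : ‖δ • g (eulerSeq g δ ξ (k + m))‖ ≤ δ * (L * (Real.exp (L * T) * ‖ξ‖)) := by
      rw [norm_smul, Real.norm_of_nonneg hδ]
      gcongr
      exact (hg _).trans (mul_le_mul_of_nonneg_left (norm_eulerSeq_le_of_le hδ hL hg hk') hL)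
    have h2 : eulerSeq g δ ξ (k + (m + 1)) - eulerSeq g δ ξ k =
        (eulerSeq g δ ξ (k + m) - eulerSeq g δ ξ k) + δ • g (eulerSeq g δ ξ (k + m)) := by
      rw [← add_assoc, eulerSeq]
      abel
    rw [h2]
    refine (norm_add_le _ _).trans ?_
    have := ih hk'
    push_cast
    linarith

/-- `p` is the average of the `m` velocities used, which convexity keeps in `C`. Nonemptiness serves
only `m = 0`. -/
theorem exists_mem_eulerSeq_add_sub_eq {C : Set E} (hC : Convex ℝ C) (hne : C.Nonempty) (k m : ℕ)
    (h : ∀ j < m, g (eulerSeq g δ ξ (k + j)) ∈ C) :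
    ∃ p ∈ C, eulerSeq g δ ξ (k + m) - eulerSeq g δ ξ k = (m * δ) • p := by
  induction m with
  | zero =>
    obtain ⟨p, hp⟩ := hne
    exact ⟨p, hp, by simp⟩
  | succ m ih =>
    obtain ⟨p, hp, hpe⟩ := ih fun j hj => h j (by omega)
    have hm : (0 : ℝ) < m + 1 := by positivity
    refine ⟨((m : ℝ) / (m + 1)) • p + ((1 : ℝ) / (m + 1)) • g (eulerSeq g δ ξ (k + m)),
      hC hp (h m (by omega)) (by positivity) (by positivity) (by field_simp), ?_⟩
    have h2 : eulerSeq g δ ξ (k + (m + 1)) - eulerSeq g δ ξ k =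
        (eulerSeq g δ ξ (k + m) - eulerSeq g δ ξ k) + δ • g (eulerSeq g δ ξ (k + m)) := by
      rw [← add_assoc, eulerSeq]
      abel
    rw [h2, hpe, smul_add, smul_smul, smul_smul]
    congr 2
    · push_cast; field_simp
    · push_cast; field_simp

/-- The step function interpolating the Euler scheme of step size `1 / (N + 1)`. -/
noncomputable def eulerStep (g : E → E) (ξ : E) (N : ℕ) (t : ℝ) : E :=
  eulerSeq g ((N : ℝ) + 1)⁻¹ ξ ⌊t * ((N : ℝ) + 1)⌋₊

theorem inv_mul_natFloor_le {M T t : ℝ} (hM : 0 < M) (hT : 0 ≤ T) (ht : t ≤ T) :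
    M⁻¹ * (⌊t * M⌋₊ : ℝ) ≤ T := by
  rw [inv_mul_le_iff₀ hM]
  have h1 : ⌊t * M⌋₊ ≤ ⌊T * M⌋₊ := Nat.floor_mono (by gcongr)
  have h2 : (⌊T * M⌋₊ : ℝ) ≤ T * M := Nat.floor_le (by positivity)
  have h3 : (⌊t * M⌋₊ : ℝ) ≤ ⌊T * M⌋₊ := by exact_mod_cast h1
  linarith

theorem inv_mul_natFloor_sub_le {M s t : ℝ} (hM : 0 < M) (hst : s ≤ t) :
    M⁻¹ * ((⌊t * M⌋₊ - ⌊s * M⌋₊ : ℕ) : ℝ) ≤ t - s + M⁻¹ := by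
  have hle : ⌊s * M⌋₊ ≤ ⌊t * M⌋₊ := Nat.floor_mono (by gcongr)
  rw [inv_mul_le_iff₀ hM, Nat.cast_sub hle, mul_add, mul_inv_cancel₀ hM.ne']
  have h1 := Nat.lt_floor_add_one (s * M)
  rcases le_total 0 (t * M) with h | h
  · have h2 := Nat.floor_le h
    linarith
  · rw [Nat.floor_of_nonpos h]
    have h3 : (0 : ℝ) ≤ ⌊s * M⌋₊ := Nat.cast_nonneg _
    have h4 : 0 ≤ M * (t - s) := mul_nonneg hM.le (by linarith)
    push_cast
    linarith

theorem norm_eulerStep_le (hL : 0 ≤ L) (hg : ∀ y, ‖g y‖ ≤ L * ‖y‖) (N : ℕ) {t T : ℝ} (hT : 0 ≤ T)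
    (ht : t ≤ T) : ‖eulerStep g ξ N t‖ ≤ Real.exp (L * T) * ‖ξ‖ :=
  norm_eulerSeq_le_of_le (by positivity) hL hg (inv_mul_natFloor_le (by positivity) hT ht)

/-- The step functions are Lipschitz up to an error of one step, which disappears in the limit. -/
theorem norm_eulerStep_sub_le (hL : 0 ≤ L) (hg : ∀ y, ‖g y‖ ≤ L * ‖y‖) (N : ℕ) {s t T : ℝ}
    (hT : 0 ≤ T) (hst : s ≤ t) (ht : t ≤ T) :
    ‖eulerStep g ξ N t - eulerStep g ξ N s‖ ≤
      L * (Real.exp (L * T) * ‖ξ‖) * (t - s + ((N : ℝ) + 1)⁻¹) := by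
  have hM : 0 < (N : ℝ) + 1 := by positivity
  have hle : ⌊s * ((N : ℝ) + 1)⌋₊ ≤ ⌊t * ((N : ℝ) + 1)⌋₊ := Nat.floor_mono (by gcongr)
  have h1 := norm_eulerSeq_add_sub_le (δ := ((N : ℝ) + 1)⁻¹) (ξ := ξ) (by positivity) hL hg (T := T)
    ⌊s * ((N : ℝ) + 1)⌋₊ (⌊t * ((N : ℝ) + 1)⌋₊ - ⌊s * ((N : ℝ) + 1)⌋₊)
    (by rw [Nat.add_sub_cancel' hle]; exact inv_mul_natFloor_le hM hT ht)
  rw [Nat.add_sub_cancel' hle] at h1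
  exact h1.trans (mul_le_mul_of_nonneg_left (inv_mul_natFloor_sub_le hM hst) (by positivity))

/-- Existence of locally Lipschitz forward solutions of a differential inclusion with closed convex
values and linear growth, as limits of Euler schemes along an ultrafilter. -/
theorem exists_forward_solution [ProperSpace E] {G : E → Set E} (hL : 0 ≤ L)
    (hg : ∀ y, ‖g y‖ ≤ L * ‖y‖) (hclosed : ∀ y, IsClosed (G y)) (hconv : ∀ y, Convex ℝ (G y))
    (hne : ∀ y, (G y).Nonempty)
    (husc : ∀ y, ∀ δ > 0, ∀ᶠ w in nhds y, g w ∈ Metric.cthickening δ (G y)) (ξ : E) :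
    ∃ x : ℝ → E, LocallyLipschitz x ∧ (∀ t ≤ 0, x t = ξ) ∧
      ∀ t > 0, ∀ v, HasDerivAt x v t → v ∈ G (x t) := by
  -- An ultrafilter gives limits at all `t` at once from boundedness alone, without extracting
  -- subsequences.
  have hlim : ∀ t, ∃ y, Filter.Tendsto (fun N => eulerStep g ξ N t)
      (Filter.hyperfilter ℕ : Filter ℕ) (nhds y) := by
    intro t
    obtain ⟨y, -, hy⟩ := (isCompact_closedBall (0 : E) (Real.exp (L * |t|) * ‖ξ‖)).ultrafilter_le_nhds'
      ((Filter.hyperfilter ℕ).map fun N => eulerStep g ξ N t) (by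
        rw [Ultrafilter.mem_map]
        refine Filter.univ_mem' fun N => ?_
        simpa using norm_eulerStep_le hL hg N (abs_nonneg t) (le_abs_self t))
    exact ⟨y, hy⟩
  choose x hx using hlim
  have htop : (Filter.hyperfilter ℕ : Filter ℕ) ≤ Filter.atTop := Nat.hyperfilter_le_atTop
  have hMtop : Filter.Tendsto (fun N : ℕ => (N : ℝ) + 1) (Filter.hyperfilter ℕ : Filter ℕ)
      Filter.atTop :=
    (Filter.tendsto_atTop_add_const_right _ _ tendsto_natCast_atTop_atTop).mono_left htop
  have hMinv : Filter.Tendsto (fun N : ℕ => ((N : ℝ) + 1)⁻¹) (Filter.hyperfilter ℕ : Filter ℕ)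
      (nhds 0) := tendsto_inv_atTop_zero.comp hMtop
  have hle : ∀ {s t T : ℝ}, 0 ≤ T → s ≤ t → t ≤ T →
      ‖x t - x s‖ ≤ L * (Real.exp (L * T) * ‖ξ‖) * (t - s) := by
    intro s t T hT hst ht
    refine le_of_tendsto_of_tendsto ((hx t).sub (hx s)).norm
      (g := fun N : ℕ => L * (Real.exp (L * T) * ‖ξ‖) * (t - s + ((N : ℝ) + 1)⁻¹)) ?_
      (Filter.Eventually.of_forall fun N => norm_eulerStep_sub_le hL hg N hT hst ht)
    simpa using (hMinv.const_add (t - s)).const_mul (L * (Real.exp (L * T) * ‖ξ‖))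
  refine ⟨x, ?_, ?_, ?_⟩
  · intro t
    refine ⟨⟨L * (Real.exp (L * (|t| + 1)) * ‖ξ‖), by positivity⟩, Set.Iic (t + 1),
      Iic_mem_nhds (by linarith), ?_⟩
    have hT : 0 ≤ |t| + 1 := by positivity
    have habs := le_abs_self t
    refine LipschitzOnWith.of_dist_le_mul fun a ha b hb => ?_
    simp only [Set.mem_Iic] at ha hb
    rw [dist_eq_norm, Real.dist_eq]
    rcases le_total b a with h | h
    · rw [abs_of_nonneg (by linarith : 0 ≤ a - b)]
      exact hle hT h (by linarith)
    · rw [abs_sub_comm, abs_of_nonneg (by linarith : 0 ≤ b - a), norm_sub_rev]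
      exact hle hT h (by linarith)
  · intro t ht
    -- The natural-number floor truncates at `0`, so the scheme rests at `ξ` for nonpositive times.
    have h1 : ∀ N, eulerStep g ξ N t = ξ := fun N => by
      rw [eulerStep, Nat.floor_of_nonpos (mul_nonpos_of_nonpos_of_nonneg ht (by positivity)), eulerSeq]
    have h2 := hx t
    simp only [h1] at h2
    exact tendsto_nhds_unique h2 tendsto_const_nhds
  · intro t ht v hv
    -- A closed set is the intersection of its closed thickenings, so it suffices to put right
    -- difference quotients into each convex thickening `C`.
    rw [← (hclosed (x t)).closure_eq, Metric.closure_eq_iInter_cthickening]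
    refine Set.mem_iInter₂.2 fun δ hδ => ?_
    set C := Metric.cthickening δ (G (x t)) with hC
    have hCc : Convex ℝ C := (hconv _).cthickening δ
    have hCne : C.Nonempty := (hne (x t)).mono (Metric.self_subset_cthickening _)
    have hCcl : IsClosed C := Metric.isClosed_cthickening
    obtain ⟨ε, hε, hball⟩ := Metric.eventually_nhds_iff.1 (husc (x t) δ hδ)
    set K := L * (Real.exp (L * (t + 1)) * ‖ξ‖) with hK
    have hK0 : 0 ≤ K := by positivity
    -- The bound by `1` keeps `t + r` within the horizon `t + 1` of `K`. The other bound gives `K *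
    -- r ≤ ε / 4`; with `ε / 4` each for the step error and the limit error, the Euler points on
    -- `[t, t + r]` stay within `ε` of `x t`.
    set ρ := min 1 (ε / (4 * (K + 1))) with hρ
    have hρ0 : 0 < ρ := by positivity
    refine hCcl.mem_of_tendsto hv.tendsto_slope_zero_right
      (Filter.mem_of_superset (Ioo_mem_nhdsGT hρ0) fun r hr => ?_)
    have hr0 : 0 < r := hr.1
    have hr1 : r < 1 := hr.2.trans_le (min_le_left _ _)
    have hrK : K * r ≤ ε / 4 := by
      have h1 : r ≤ ε / (4 * (K + 1)) := hr.2.le.trans (min_le_right _ _)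
      rw [le_div_iff₀ (by positivity)] at h1
      nlinarith
    have hratio : Filter.Tendsto (fun N : ℕ =>
        ((⌊(t + r) * ((N : ℝ) + 1)⌋₊ - ⌊t * ((N : ℝ) + 1)⌋₊ : ℕ) : ℝ) * ((N : ℝ) + 1)⁻¹)
        (Filter.hyperfilter ℕ : Filter ℕ) (nhds r) := by
      have h1 := ((tendsto_nat_floor_mul_div_atTop (R := ℝ) (a := t + r) (by linarith)).comp
        hMtop).sub ((tendsto_nat_floor_mul_div_atTop (R := ℝ) (a := t) ht.le).comp hMtop)
      rw [add_sub_cancel_left] at h1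
      refine h1.congr fun N => ?_
      have hfl : ⌊t * ((N : ℝ) + 1)⌋₊ ≤ ⌊(t + r) * ((N : ℝ) + 1)⌋₊ :=
        Nat.floor_mono (by gcongr; linarith)
      simp only [Function.comp_apply]
      rw [Nat.cast_sub hfl]
      ring
    have hmem : ∀ᶠ N in (Filter.hyperfilter ℕ : Filter ℕ), ∃ p ∈ C,
        eulerStep g ξ N (t + r) - eulerStep g ξ N t =
          (((⌊(t + r) * ((N : ℝ) + 1)⌋₊ - ⌊t * ((N : ℝ) + 1)⌋₊ : ℕ) : ℝ) * ((N : ℝ) + 1)⁻¹) • p := by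
      have e1 : ∀ᶠ N in (Filter.hyperfilter ℕ : Filter ℕ), dist (eulerStep g ξ N t) (x t) < ε / 4 :=
        (hx t).eventually (Metric.ball_mem_nhds _ (by linarith))
      have e2 : ∀ᶠ N : ℕ in (Filter.hyperfilter ℕ : Filter ℕ), K * ((N : ℝ) + 1)⁻¹ < ε / 4 := by
        have := hMinv.const_mul K
        rw [mul_zero] at this
        exact this.eventually_lt_const (by linarith)
      filter_upwards [e1, e2] with N h1 h2
      have hM : 0 < (N : ℝ) + 1 := by positivity
      have hfl : ⌊t * ((N : ℝ) + 1)⌋₊ ≤ ⌊(t + r) * ((N : ℝ) + 1)⌋₊ :=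
        Nat.floor_mono (by gcongr; linarith)
      obtain ⟨p, hp, hpe⟩ := exists_mem_eulerSeq_add_sub_eq (g := g) (δ := ((N : ℝ) + 1)⁻¹) (ξ := ξ)
        hCc hCne ⌊t * ((N : ℝ) + 1)⌋₊ (⌊(t + r) * ((N : ℝ) + 1)⌋₊ - ⌊t * ((N : ℝ) + 1)⌋₊) (by
          intro j hj
          refine hball ?_
          have hkj : ⌊t * ((N : ℝ) + 1)⌋₊ + j ≤ ⌊(t + r) * ((N : ℝ) + 1)⌋₊ := by omega
          have h3 := norm_eulerSeq_add_sub_le (g := g) (δ := ((N : ℝ) + 1)⁻¹) (ξ := ξ) (T := t + 1)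
            (by positivity) hL hg ⌊t * ((N : ℝ) + 1)⌋₊ j (by
              refine le_trans ?_ (inv_mul_natFloor_le hM (by linarith) (by linarith : t + r ≤ t + 1))
              gcongr)
          have h4 : ((N : ℝ) + 1)⁻¹ * j ≤ r + ((N : ℝ) + 1)⁻¹ := by
            have h5 := inv_mul_natFloor_sub_le hM (by linarith : t ≤ t + r)
            have h6 : ((N : ℝ) + 1)⁻¹ * j ≤ ((N : ℝ) + 1)⁻¹ *
                ((⌊(t + r) * ((N : ℝ) + 1)⌋₊ - ⌊t * ((N : ℝ) + 1)⌋₊ : ℕ) : ℝ) := by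
              gcongr
            linarith
          have h7 := mul_le_mul_of_nonneg_left h4 hK0
          have h8 := dist_triangle (eulerSeq g ((N : ℝ) + 1)⁻¹ ξ (⌊t * ((N : ℝ) + 1)⌋₊ + j))
            (eulerStep g ξ N t) (x t)
          rw [← hK, ← dist_eq_norm] at h3
          have h9 : dist (eulerSeq g ((N : ℝ) + 1)⁻¹ ξ (⌊t * ((N : ℝ) + 1)⌋₊ + j))
            (eulerStep g ξ N t) ≤ K * (((N : ℝ) + 1)⁻¹ * j) := h3
          linarith)
      rw [Nat.add_sub_cancel' hfl] at hpe
      exact ⟨p, hp, hpe⟩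
    -- For the schemes, the increment divided by the exact elapsed time lies in `C`; the elapsed
    -- time tends to `r`.
    refine hCcl.mem_of_tendsto ((hratio.inv₀ hr0.ne').smul ((hx (t + r)).sub (hx t))) ?_
    filter_upwards [hmem, hratio.eventually_const_lt hr0] with N hN hpos
    obtain ⟨p, hp, hpe⟩ := hN
    rw [hpe, smul_smul, inv_mul_cancel₀ hpos.ne', one_smul]
    exact hp

end Euler

/-! ### Extending local pieces to Filippov solutions on the whole line -/

theorem LocallyLipschitz.absolutelyContinuousOnInterval {E : Type*} [NormedAddCommGroup E]
    {f : ℝ → E} (hf : LocallyLipschitz f) (a b : ℝ) : AbsolutelyContinuousOnInterval f a b := by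
  obtain ⟨K, hK⟩ := (hf.locallyLipschitzOn (s := Set.uIcc a b)).exists_lipschitzOnWith_of_compact
    isCompact_uIcc
  exact hK.absolutelyContinuousOnInterval

theorem LocallyLipschitz.ae_differentiableAt_of_real {E : Type*} [NormedAddCommGroup E]
    [NormedSpace ℝ E] [FiniteDimensional ℝ E] {f : ℝ → E} (hf : LocallyLipschitz f) :
    ∀ᵐ t : ℝ, DifferentiableAt ℝ f t := by
  refine LocallyBoundedVariationOn.ae_differentiableAt fun a b _ _ => ?_
  refine (hf.absolutelyContinuousOnInterval a b).boundedVariationOn.mono ?_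
  rw [Set.univ_inter]
  exact Set.Icc_subset_uIcc

section Filippov

variable {n : ℕ}

/-- The Euler scheme follows a discontinuous selection (mode 2 on the hyperplane). Upper
semicontinuity holds because the segment on the hyperplane contains both modes, while off it the
mode is locally constant. -/
theorem exists_forward_filippov (A₁ A₂ : Matrix (Fin n) (Fin n) ℝ) (c ξ : Fin n → ℝ) :
    ∃ x : ℝ → Fin n → ℝ, LocallyLipschitz x ∧ (∀ t ≤ 0, x t = ξ) ∧
      ∀ t > 0, ∀ v, HasDerivAt x v t → v ∈ filippovMap A₁ A₂ 0 0 c 0 (x t) := by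
  set L₁ := LinearMap.toContinuousLinearMap A₁.mulVecLin with hL₁
  set L₂ := LinearMap.toContinuousLinearMap A₂.mulVecLin with hL₂
  have e₁ : ∀ y, A₁ *ᵥ y = L₁ y := fun y => rfl
  have e₂ : ∀ y, A₂ *ᵥ y = L₂ y := fun y => rfl
  refine exists_forward_solution (g := fun y => if c ⬝ᵥ y < 0 then A₁ *ᵥ y else A₂ *ᵥ y)
    (L := ‖L₁‖ + ‖L₂‖) (by positivity) ?_ ?_ ?_ ?_ ?_ ξ
  · intro y
    have h1 := L₁.le_opNorm y
    have h2 := L₂.le_opNorm y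
    have h3 : 0 ≤ ‖L₁‖ * ‖y‖ := by positivity
    have h4 : 0 ≤ ‖L₂‖ * ‖y‖ := by positivity
    rw [add_mul]
    split_ifs
    · rw [e₁]; linarith
    · rw [e₂]; linarith
  · intro y
    rcases lt_trichotomy (c ⬝ᵥ y) 0 with hy | hy | hy
    · rw [filippovMap_of_neg hy]; exact isClosed_singleton
    · rw [filippovMap_of_zero hy, ← convexHull_pair]
      exact ((Set.toFinite _).isCompact_convexHull ℝ).isClosed
    · rw [filippovMap_of_pos hy]; exact isClosed_singleton
  · intro y
    rcases lt_trichotomy (c ⬝ᵥ y) 0 with hy | hy | hy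
    · rw [filippovMap_of_neg hy]; exact convex_singleton _
    · rw [filippovMap_of_zero hy]; exact convex_segment _ _
    · rw [filippovMap_of_pos hy]; exact convex_singleton _
  · intro y
    rcases lt_trichotomy (c ⬝ᵥ y) 0 with hy | hy | hy
    · rw [filippovMap_of_neg hy]; exact Set.singleton_nonempty _
    · rw [filippovMap_of_zero hy]; exact ⟨_, left_mem_segment _ _ _⟩
    · rw [filippovMap_of_pos hy]; exact Set.singleton_nonempty _
  · intro y δ hδ
    have h1 : ∀ᶠ w in nhds y, dist (A₁ *ᵥ w) (A₁ *ᵥ y) < δ :=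
      L₁.continuous.continuousAt.eventually (Metric.ball_mem_nhds _ hδ)
    have h2 : ∀ᶠ w in nhds y, dist (A₂ *ᵥ w) (A₂ *ᵥ y) < δ :=
      L₂.continuous.continuousAt.eventually (Metric.ball_mem_nhds _ hδ)
    have hc : ContinuousAt (fun w => c ⬝ᵥ w) y :=
      (dotProductCLM c).continuous.continuousAt.congr (.of_forall fun w => dotProductCLM_apply c w)
    rcases lt_trichotomy (c ⬝ᵥ y) 0 with hy | hy | hy
    · filter_upwards [h1, hc.eventually_lt_const hy] with w hw hcw
      rw [filippovMap_of_neg hy, if_pos hcw]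
      exact Metric.mem_cthickening_of_dist_le _ _ _ _ (Set.mem_singleton _) hw.le
    · filter_upwards [h1, h2] with w hw hw'
      rw [filippovMap_of_zero hy]
      split_ifs
      · exact Metric.mem_cthickening_of_dist_le _ _ _ _ (left_mem_segment _ _ _) hw.le
      · exact Metric.mem_cthickening_of_dist_le _ _ _ _ (right_mem_segment _ _ _) hw'.le
    · filter_upwards [h2, hc.eventually_const_lt hy] with w hw hcw
      rw [filippovMap_of_pos hy, if_neg hcw.not_gt]
      exact Metric.mem_cthickening_of_dist_le _ _ _ _ (Set.mem_singleton _) hw.le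

/-- A locally Lipschitz function which satisfies the differential inclusion on `(0, τ)` agrees on
`[0, τ]` with a Filippov solution defined on the whole time axis. -/
theorem exists_isFilippovSolution_extending {A₁ A₂ : Matrix (Fin n) (Fin n) ℝ} {c : Fin n → ℝ}
    {y : ℝ → Fin n → ℝ} (hy : LocallyLipschitz y) {τ : ℝ} (hτ : 0 < τ)
    (hd : ∀ t ∈ Set.Ioo 0 τ, ∃ v ∈ filippovMap A₁ A₂ 0 0 c 0 (y t), HasDerivAt y v t) :
    ∃ x, IsFilippovSolution A₁ A₂ 0 0 c 0 (y 0) x ∧ ∀ t ∈ Set.Icc 0 τ, x t = y t := by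
  obtain ⟨p, hpL, hp0, hpd⟩ := exists_forward_filippov A₁ A₂ c (y τ)
  obtain ⟨q, hqL, hq0, hqd⟩ := exists_forward_filippov (-A₁) (-A₂) c (y 0)
  -- Each of the three summands is constant outside its own time interval, so the sum corrected by
  -- `y 0 + y τ` is the concatenation, and local Lipschitz continuity needs no case distinction.
  set x : ℝ → Fin n → ℝ := fun t => q (-t) + y (max 0 (min t τ)) + p (t - τ) - (y 0 + y τ) with hx
  have hneg : ∀ t ≤ 0, x t = q (-t) := fun t ht => by
    simp [hx, min_eq_left (ht.trans hτ.le), max_eq_left ht, hp0 (t - τ) (by linarith)]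
  have hmid : ∀ t ∈ Set.Icc 0 τ, x t = y t := fun t ht => by
    simp [hx, min_eq_left ht.2, max_eq_right ht.1, hp0 (t - τ) (by linarith [ht.2]),
      hq0 (-t) (by linarith [ht.1])]
  have hpos : ∀ t ≥ τ, x t = p (t - τ) := fun t ht => by
    simp [hx, min_eq_right ht, max_eq_right hτ.le, hq0 (-t) (by linarith)]
  have hxL : LocallyLipschitz x := by
    have h1 : LocallyLipschitz (fun t : ℝ => q (-t)) :=
      hqL.comp (contDiff_neg (𝕜 := ℝ) (F := ℝ) (n := 1)).locallyLipschitz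
    have h2 : LocallyLipschitz (fun t : ℝ => y (max 0 (min t τ))) :=
      hy.comp ((LocallyLipschitz.id.min_const τ).const_max 0)
    have h3 : LocallyLipschitz (fun t : ℝ => p (t - τ)) :=
      hpL.comp (ContDiff.locallyLipschitz (𝕂 := ℝ) (by fun_prop))
    exact ((h1.add h2).add h3).sub (LocallyLipschitz.const _)
  refine ⟨x, ⟨hxL.absolutelyContinuousOnInterval, hmid 0 ⟨le_rfl, hτ.le⟩, ?_⟩, hmid⟩
  have hfin : ∀ᵐ t : ℝ, t ∉ ({0, τ} : Set ℝ) :=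
    measure_eq_zero_iff_ae_notMem.1 ((Set.toFinite _).measure_zero _)
  filter_upwards [hxL.ae_differentiableAt_of_real, hfin] with t htd hne
  simp only [Set.mem_insert_iff, Set.mem_singleton_iff, not_or] at hne
  have hxd := htd.hasDerivAt
  rcases lt_or_gt_of_ne hne.1 with h0 | h0
  · refine ⟨_, ?_, hxd⟩
    have heq : x =ᶠ[nhds t] fun s => q (-s) :=
      Filter.mem_of_superset (Iio_mem_nhds h0) fun s hs => hneg s (le_of_lt hs)
    have h1 : HasDerivAt (fun s => q (-s)) (deriv x t) (- -t) := by
      rw [neg_neg]; exact hxd.congr_of_eventuallyEq heq.symm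
    have h2 := h1.scomp (-t) (hasDerivAt_neg (-t))
    have h3 : HasDerivAt q (-deriv x t) (-t) := by simpa [Function.comp_def] using h2
    have h4 := filippovMap_neg (hqd (-t) (by linarith) _ h3)
    rw [hneg t h0.le]
    simpa using h4
  · rcases lt_or_gt_of_ne hne.2 with h1 | h1
    · have heq : x =ᶠ[nhds t] y :=
        Filter.mem_of_superset (Ioo_mem_nhds h0 h1) fun s hs => hmid s ⟨hs.1.le, hs.2.le⟩
      obtain ⟨v, hv, hvd⟩ := hd t ⟨h0, h1⟩
      rw [hmid t ⟨h0.le, h1.le⟩]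
      exact ⟨v, hv, hvd.congr_of_eventuallyEq heq⟩
    · refine ⟨_, ?_, hxd⟩
      have heq : x =ᶠ[nhds t] fun s => p (s - τ) :=
        Filter.mem_of_superset (Ioi_mem_nhds h1) fun s hs => hpos s (le_of_lt hs)
      have h2 : HasDerivAt (fun s => p (s - τ)) (deriv x t) (t - τ + τ) := by
        rw [sub_add_cancel]; exact hxd.congr_of_eventuallyEq heq.symm
      have h3 : HasDerivAt p (deriv x t) (t - τ) := by
        simpa using h2.comp_add_const (t - τ) τ
      rw [hpos t h1.le]
      exact hpd (t - τ) (by linarith) _ h3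

end Filippov

/-! ### Observability and the sign of the first nonzero output derivative -/

section Observability

variable {n : ℕ}

theorem vecMul_pow_succ (c : Fin n → ℝ) (A : Matrix (Fin n) (Fin n) ℝ) (i : ℕ) :
    c ᵥ* A ^ (i + 1) = (c ᵥ* A ^ i) ᵥ* A := by
  rw [pow_succ, vecMul_vecMul]

theorem observabilityIndex_zero (A : Matrix (Fin n) (Fin n) ℝ) :
    observabilityIndex (0 : Fin n → ℝ) A = 0 := by
  have : {k : ℕ | LinearIndependent ℝ (obsMatrix (0 : Fin n → ℝ) A k).row} = ∅ := by
    refine Set.eq_empty_iff_forall_notMem.2 fun k hk => ?_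
    exact LinearIndependent.ne_zero (R := ℝ) 0 hk (by ext; simp [obsMatrix])
  rw [observabilityIndex, this]
  simp

/-- Otherwise the next row could be adjoined independently, against maximality of the index. For `c
= 0` the row itself is zero. -/
theorem vecMul_pow_observabilityIndex_succ_mem (c : Fin n → ℝ) (A : Matrix (Fin n) (Fin n) ℝ) :
    c ᵥ* A ^ (observabilityIndex c A + 1) ∈
      Submodule.span ℝ ((fun i => c ᵥ* A ^ i) '' Set.Iic (observabilityIndex c A)) := by
  by_cases hc : c = 0
  · subst hc
    simp
  have hgr := observabilityIndex_isGreatest c hc A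
  generalize observabilityIndex c A = h at hgr ⊢
  by_contra hmem
  have hli : LinearIndependent ℝ (obsMatrix c A (h + 1)).row := by
    refine linearIndependent_finSucc'.2 ⟨hgr.1, fun hspan => hmem ?_⟩
    refine Submodule.span_mono ?_ hspan
    rintro _ ⟨i, rfl⟩
    exact ⟨i, Nat.lt_succ_iff.1 i.2, rfl⟩
  have := hgr.2 hli
  omega

/-- A single linear system is the case of equal modes with gains `1`, so the chain results also
serve its flow. -/
theorem isIntegratorChain_self (c : Fin n → ℝ) (A : Matrix (Fin n) (Fin n) ℝ) :
    IsIntegratorChain A A (observabilityIndex c A) (fun i => c ᵥ* A ^ i) := by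
  have hstep : ∀ i < observabilityIndex c A, ∃ a > (0 : ℝ), (c ᵥ* A ^ i) ᵥ* A - a • c ᵥ* A ^ (i + 1) ∈
      Submodule.span ℝ ((fun i => c ᵥ* A ^ i) '' Set.Iic i) := fun i _ =>
    ⟨1, one_pos, by simp [vecMul_pow_succ c A i]⟩
  have hlast := vecMul_pow_observabilityIndex_succ_mem c A
  rw [vecMul_pow_succ] at hlast
  exact ⟨hstep, hstep, hlast, hlast, fun _ _ => rfl⟩

theorem vecMul_pow_mem (c : Fin n → ℝ) (A : Matrix (Fin n) (Fin n) ℝ) (k : ℕ) :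
    c ᵥ* A ^ k ∈ Submodule.span ℝ ((fun i => c ᵥ* A ^ i) '' Set.Iic (observabilityIndex c A)) := by
  induction k with
  | zero => exact Submodule.subset_span ⟨0, Nat.zero_le _, rfl⟩
  | succ k ih =>
    rw [vecMul_pow_succ]
    have hle : Submodule.span ℝ ((fun i => c ᵥ* A ^ i) '' Set.Iic (observabilityIndex c A)) ≤
        (Submodule.span ℝ ((fun i => c ᵥ* A ^ i) '' Set.Iic (observabilityIndex c A))).comap
          A.vecMulLinear := by
      rw [Submodule.span_le]
      rintro _ ⟨j, hj, rfl⟩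
      exact ((isIntegratorChain_self c A).vecMul_mem hj).1
    exact hle ih

theorem obsMatrix_mulVec_apply (c : Fin n → ℝ) (A : Matrix (Fin n) (Fin n) ℝ) (k : ℕ)
    (x : Fin n → ℝ) (i : Fin (k + 1)) :
    (obsMatrix c A k *ᵥ x) i = (c ᵥ* A ^ (i : ℕ)) ⬝ᵥ x := rfl

/-- The state `ξ` is unobservable from the output `cᵀx` of `x' = A x`. -/
def IsUnobservable (A : Matrix (Fin n) (Fin n) ℝ) (c ξ : Fin n → ℝ) : Prop :=
  ∀ k : ℕ, (c ᵥ* A ^ k) ⬝ᵥ ξ = 0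

/-- The first nonvanishing derivative of the output `cᵀx` of `x' = A x`, `x 0 = ξ`, is positive. -/
def IsLexPos (A : Matrix (Fin n) (Fin n) ℝ) (c ξ : Fin n → ℝ) : Prop :=
  ∃ k : ℕ, (∀ j < k, (c ᵥ* A ^ j) ⬝ᵥ ξ = 0) ∧ 0 < (c ᵥ* A ^ k) ⬝ᵥ ξ

variable {A : Matrix (Fin n) (Fin n) ℝ} {c ξ : Fin n → ℝ}

theorem isUnobservable_neg : IsUnobservable A c (-ξ) ↔ IsUnobservable A c ξ := by
  simp [IsUnobservable]

theorem IsLexPos.not_isUnobservable (h : IsLexPos A c ξ) : ¬ IsUnobservable A c ξ := fun hu => by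
  obtain ⟨k, -, hk⟩ := h
  exact hk.ne' (hu k)

theorem isUnobservable_or_isLexPos (A : Matrix (Fin n) (Fin n) ℝ) (c ξ : Fin n → ℝ) :
    IsUnobservable A c ξ ∨ IsLexPos A c ξ ∨ IsLexPos A c (-ξ) := by
  classical
  by_cases h : IsUnobservable A c ξ
  · exact Or.inl h
  · right
    simp only [IsUnobservable, not_forall] at h
    have hlt : ∀ j < Nat.find h, (c ᵥ* A ^ j) ⬝ᵥ ξ = 0 := fun j hj => not_not.1 (Nat.find_min h hj)
    rcases lt_or_gt_of_ne (Nat.find_spec h) with hneg | hpos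
    · exact Or.inr ⟨Nat.find h, fun j hj => by simp [hlt j hj], by simpa using hneg⟩
    · exact Or.inl ⟨Nat.find h, hlt, hpos⟩

/-- All higher rows are combinations of those up to the index. -/
theorem isUnobservable_iff :
    IsUnobservable A c ξ ↔ obsMatrix c A (observabilityIndex c A) *ᵥ ξ = 0 := by
  constructor
  · intro h
    funext i
    exact h i
  · intro h k
    obtain ⟨B, -, hB⟩ := exists_abs_dotProduct_le_of_mem_span (vecMul_pow_mem c A k)
    have h0 : ∑ j ∈ Finset.range (observabilityIndex c A + 1), |(c ᵥ* A ^ j) ⬝ᵥ ξ| = 0 := by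
      refine Finset.sum_eq_zero fun j hj => ?_
      have := congrFun h ⟨j, Finset.mem_range.1 hj⟩
      rw [obsMatrix_mulVec_apply] at this
      rw [abs_eq_zero]
      exact this
    have := hB ξ
    rw [h0, mul_zero] at this
    exact abs_nonpos_iff.1 this

end Observability

/-! ### Linear flows as Filippov solutions -/

section Flow

variable {n : ℕ} {A A₁ A₂ : Matrix (Fin n) (Fin n) ℝ} {c ξ : Fin n → ℝ} {E : ℝ → Fin n → ℝ}

theorem exists_linear_flow (A : Matrix (Fin n) (Fin n) ℝ) (ξ : Fin n → ℝ) :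
    ∃ E : ℝ → Fin n → ℝ, E 0 = ξ ∧ (∀ t, HasDerivAt E (A *ᵥ E t) t) ∧ LocallyLipschitz E := by
  set L : (Fin n → ℝ) →L[ℝ] (Fin n → ℝ) := LinearMap.toContinuousLinearMap A.mulVecLin with hL
  have hd : ∀ t : ℝ, HasDerivAt (fun u : ℝ => NormedSpace.exp (u • L) ξ)
      (A *ᵥ (NormedSpace.exp (t • L) ξ)) t := by
    intro t
    have h1 := hasDerivAt_exp_smul_const' (𝕂 := ℝ) L t
    have h2 := h1.clm_apply (hasDerivAt_const t ξ)
    simpa [hL] using h2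
  refine ⟨_, by simp, hd, ContDiff.locallyLipschitz (𝕂 := ℝ) (contDiff_one_iff_deriv.2
    ⟨fun t => (hd t).differentiableAt, ?_⟩)⟩
  rw [funext fun t => (hd t).deriv]
  have hc : Continuous fun u : ℝ => NormedSpace.exp (u • L) ξ :=
    continuous_iff_continuousAt.2 fun t => (hd t).continuousAt
  exact L.continuous.comp hc

theorem flow_pos (hE : ∀ t, HasDerivAt E (A *ᵥ E t) t) (hL : LocallyLipschitz E)
    (h : IsLexPos A c (E 0)) : ∃ τ > 0, ∀ t ∈ Set.Ioo 0 τ, 0 < c ⬝ᵥ E t := by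
  obtain ⟨k, h0, hk⟩ := h
  have := chain_pos (z := fun i t => (c ᵥ* A ^ i) ⬝ᵥ E t) one_pos one_pos zero_le_one
    (fun j _ => (hL.absolutelyContinuousOnInterval 0 1).const_dotProduct _) h0 hk
    (Filter.Eventually.of_forall fun t _ i _ => ⟨_, 1, le_rfl, le_rfl, by
      rw [one_mul, vecMul_pow_succ, dotProduct_mulVec, sub_self, abs_zero, one_mul]
      exact Finset.sum_nonneg fun _ _ => abs_nonneg _, (hE t).const_dotProduct _⟩)
  simpa using this

theorem flow_neg (hE : ∀ t, HasDerivAt E (A *ᵥ E t) t) (hL : LocallyLipschitz E)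
    (h : IsLexPos A c (-E 0)) : ∃ τ > 0, ∀ t ∈ Set.Ioo 0 τ, c ⬝ᵥ E t < 0 := by
  obtain ⟨τ, hτ, hpos⟩ := flow_pos (E := -E) (fun t => by
    simpa [mulVec_neg] using (hE t).neg) (ContDiff.locallyLipschitz (𝕂 := ℝ) contDiff_neg |>.comp hL) h
  exact ⟨τ, hτ, fun t ht => by simpa using hpos t ht⟩

theorem flow_zero (hE : ∀ t, HasDerivAt E (A *ᵥ E t) t) (hL : LocallyLipschitz E)
    (h : IsUnobservable A c (E 0)) : ∀ t ≥ 0, c ⬝ᵥ E t = 0 := by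
  intro t ht
  have := (isIntegratorChain_self c A).output_zero hL.absolutelyContinuousOnInterval
    (Filter.Eventually.of_forall fun t => ⟨_, by rw [segment_same]; rfl, hE t⟩)
    (fun j _ => h j) t ht 0 (Nat.zero_le _)
  simpa using this

/-- If right uniqueness holds, then no nontrivial initial state can be left along both modes. -/
theorem isUnobservable_of_rightUnique
    (huniq : ∀ (ξ : Fin n → ℝ) (x : ℝ → Fin n → ℝ), IsFilippovSolution A₁ A₂ 0 0 c 0 ξ x →
      IsRightUnique A₁ A₂ 0 0 c 0 ξ x)
    (h₁ : IsUnobservable A₁ c ξ ∨ IsLexPos A₁ c (-ξ)) (h₂ : IsUnobservable A₂ c ξ ∨ IsLexPos A₂ c ξ) :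
    IsUnobservable A₁ c ξ ∧ IsUnobservable A₂ c ξ ∧ A₁ *ᵥ ξ = A₂ *ᵥ ξ := by
  obtain ⟨E, hE0, hE, hEL⟩ := exists_linear_flow A₁ ξ
  obtain ⟨F, hF0, hF, hFL⟩ := exists_linear_flow A₂ ξ
  have hEs : ∃ τ > 0, (IsUnobservable A₁ c ξ ∧ ∀ t ∈ Set.Ioo 0 τ, c ⬝ᵥ E t = 0) ∨
      ∀ t ∈ Set.Ioo 0 τ, c ⬝ᵥ E t < 0 := by
    rcases h₁ with h | h
    · exact ⟨1, one_pos, Or.inl ⟨h, fun t ht => flow_zero hE hEL (hE0 ▸ h) t ht.1.le⟩⟩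
    · obtain ⟨τ, hτ, H⟩ := flow_neg hE hEL (hE0 ▸ h)
      exact ⟨τ, hτ, Or.inr H⟩
  have hFs : ∃ τ > 0, (IsUnobservable A₂ c ξ ∧ ∀ t ∈ Set.Ioo 0 τ, c ⬝ᵥ F t = 0) ∨
      ∀ t ∈ Set.Ioo 0 τ, 0 < c ⬝ᵥ F t := by
    rcases h₂ with h | h
    · exact ⟨1, one_pos, Or.inl ⟨h, fun t ht => flow_zero hF hFL (hF0 ▸ h) t ht.1.le⟩⟩
    · obtain ⟨τ, hτ, H⟩ := flow_pos hF hFL (hF0 ▸ h)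
      exact ⟨τ, hτ, Or.inr H⟩
  obtain ⟨τ, hτ, hEs⟩ := hEs
  obtain ⟨σ, hσ, hFs⟩ := hFs
  -- On the hyperplane the velocity of either mode is an endpoint of the segment, so a flow that
  -- stays there is admissible too.
  obtain ⟨x, hx, hxE⟩ := exists_isFilippovSolution_extending (A₁ := A₁) (A₂ := A₂) (c := c) hEL hτ
    (fun t ht => ⟨_, by
      rcases hEs with ⟨-, H⟩ | H
      · rw [filippovMap_of_zero (H t ht)]; exact left_mem_segment _ _ _
      · rw [filippovMap_of_neg (H t ht)]; rfl, hE t⟩)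
  obtain ⟨y, hy, hyF⟩ := exists_isFilippovSolution_extending (A₁ := A₁) (A₂ := A₂) (c := c) hFL hσ
    (fun t ht => ⟨_, by
      rcases hFs with ⟨-, H⟩ | H
      · rw [filippovMap_of_zero (H t ht)]; exact right_mem_segment _ _ _
      · rw [filippovMap_of_pos (H t ht)]; rfl, hF t⟩)
  rw [hE0] at hx
  rw [hF0] at hy
  obtain ⟨ε, hε, hxy⟩ := huniq ξ x hx y hy
  set δ := min ε (min τ σ) with hδ
  have hδ0 : 0 < δ := lt_min hε (lt_min hτ hσ)
  have hEF : ∀ t ∈ Set.Ico 0 δ, E t = F t := by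
    intro t ht
    have h1 : t < ε := ht.2.trans_le (min_le_left _ _)
    have h2 : t < τ := ht.2.trans_le ((min_le_right _ _).trans (min_le_left _ _))
    have h3 : t < σ := ht.2.trans_le ((min_le_right _ _).trans (min_le_right _ _))
    rw [← hxE t ⟨ht.1, h2.le⟩, ← hyF t ⟨ht.1, h3.le⟩]
    exact hxy t ⟨ht.1, h1⟩
  have hmem : δ / 2 ∈ Set.Ico 0 δ := ⟨by positivity, by linarith⟩
  have hmemτ : δ / 2 ∈ Set.Ioo 0 τ :=
    ⟨by positivity, hmem.2.trans_le ((min_le_right _ _).trans (min_le_left _ _))⟩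
  have hmemσ : δ / 2 ∈ Set.Ioo 0 σ :=
    ⟨by positivity, hmem.2.trans_le ((min_le_right _ _).trans (min_le_right _ _))⟩
  have hout : c ⬝ᵥ E (δ / 2) = c ⬝ᵥ F (δ / 2) := by rw [hEF _ hmem]
  -- The flows agree only to the right of `0`, so one-sided derivatives are compared.
  have hder : A₁ *ᵥ ξ = A₂ *ᵥ ξ := by
    have h1 : HasDerivWithinAt E (A₁ *ᵥ ξ) (Set.Ici 0) 0 := by
      simpa [hE0] using (hE 0).hasDerivWithinAt (s := Set.Ici 0)
    have h2 : HasDerivWithinAt F (A₂ *ᵥ ξ) (Set.Ici 0) 0 := by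
      simpa [hF0] using (hF 0).hasDerivWithinAt (s := Set.Ici 0)
    have h3 : HasDerivWithinAt E (A₂ *ᵥ ξ) (Set.Ici 0) 0 :=
      h2.congr_of_eventuallyEq (Filter.mem_of_superset (Ico_mem_nhdsGE hδ0) hEF) (by rw [hE0, hF0])
    exact (uniqueDiffWithinAt_Ici (0 : ℝ)).eq_deriv _ h1 h3
  rcases hEs with ⟨hz₁, H₁⟩ | H₁ <;> rcases hFs with ⟨hz₂, H₂⟩ | H₂
  · exact ⟨hz₁, hz₂, hder⟩
  · have := H₁ _ hmemτ
    have := H₂ _ hmemσ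
    linarith
  · have := H₁ _ hmemτ
    have := H₂ _ hmemσ
    linarith
  · have := H₁ _ hmemτ
    have := H₂ _ hmemσ
    linarith

end Flow

/-! ### Lexicographic positivity, triangular factors and chains -/

section Algebra

/-- A matrix preserving lexicographic positivity is lower triangular with nonnegative diagonal. -/
theorem Matrix.isLowerTriangular_of_lex_pos {m : ℕ} (M : Matrix (Fin m) (Fin m) ℝ)
    (hM : ∀ z : Fin m → ℝ, (∃ k, (∀ j < k, z j = 0) ∧ 0 < z k) →
      ∃ k, (∀ j < k, (M *ᵥ z) j = 0) ∧ 0 < (M *ᵥ z) k) :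
    M.IsLowerTriangular ∧ ∀ i, 0 ≤ M i i := by
  have key : ∀ k : ℕ, ∀ i : Fin m, (i : ℕ) = k → (∀ j, i < j → M i j = 0) ∧ 0 ≤ M i i := by
    intro k
    induction k using Nat.strong_induction_on with
    | _ k ih =>
      intro i hik
      have hrow : ∀ l < i, ∀ j, i ≤ j → M l j = 0 := fun l hl j hj =>
        (ih l (by omega) l rfl).1 j (hl.trans_le hj)
      -- The rows above `i` vanish in the columns from `i` on, so they annihilate `z`; the first
      -- nonzero entry of `M *ᵥ z` cannot come before `i`.
      have hlead : ∀ z : Fin m → ℝ, (∀ j < i, z j = 0) → 0 < z i → 0 ≤ (M *ᵥ z) i := by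
        intro z hz hzi
        have hlow : ∀ l < i, (M *ᵥ z) l = 0 := fun l hl => by
          change ∑ j, M l j * z j = 0
          refine Finset.sum_eq_zero fun j _ => ?_
          rcases lt_or_ge j i with hj | hj
          · rw [hz j hj, mul_zero]
          · rw [hrow l hl j hj, zero_mul]
        obtain ⟨p, hp0, hp⟩ := hM z ⟨i, hz, hzi⟩
        rcases lt_trichotomy p i with h | h | h
        · exact absurd (hlow p h) hp.ne'
        · exact h ▸ hp.le
        · exact (hp0 i h).ge
      have hdiag : 0 ≤ M i i := by
        have := hlead (Pi.single i 1) (fun j hj => Pi.single_eq_of_ne hj.ne _) (by simp)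
        simpa using this
      refine ⟨fun j hj => ?_, hdiag⟩
      by_contra hne
      -- The multiple of the `j`-th unit vector is chosen to make entry `i` of the image equal to
      -- `-1`.
      have := hlead (Pi.single i 1 + (-(M i i + 1) / M i j) • Pi.single j 1)
        (fun l hl => by simp [Pi.single_eq_of_ne hl.ne, Pi.single_eq_of_ne (hl.trans hj).ne])
        (by simp [Pi.single_eq_of_ne hj.ne])
      simp only [mulVec_add, mulVec_smul, mulVec_single_one, Pi.add_apply, Pi.smul_apply, col_apply,
        smul_eq_mul, div_mul_cancel₀ _ hne] at this
      linarith
  exact ⟨fun i j hij => (key i i rfl).1 j hij, fun i => (key i i rfl).2⟩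

theorem Matrix.exists_mul_eq_one_of_linearIndependent_row {m n : ℕ} {T : Matrix (Fin m) (Fin n) ℝ}
    (hT : LinearIndependent ℝ T.row) : ∃ R : Matrix (Fin n) (Fin m) ℝ, T * R = 1 := by
  rw [← mulVec_surjective_iff_exists_right_inverse]
  have hrank : T.rank = m := by simpa using hT.rank_matrix
  have hrange : LinearMap.range T.mulVecLin = ⊤ :=
    Submodule.eq_top_of_finrank_eq (by rw [← Matrix.rank, hrank]; simp)
  exact LinearMap.range_eq_top.1 hrange

/-- The kernel inclusion lets the first matrix factor through the second, via a right inverse `R`.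
The factor inherits preservation of lexicographic positivity from `hlex`, and independence of the
rows of the first matrix makes it invertible. -/
theorem exists_isLowerTriangular_obsMatrix {n h : ℕ} {A₁ A₂ : Matrix (Fin n) (Fin n) ℝ}
    {c : Fin n → ℝ} (hli₁ : LinearIndependent ℝ (obsMatrix c A₁ h).row)
    (hli₂ : LinearIndependent ℝ (obsMatrix c A₂ h).row)
    (hker : ∀ x, obsMatrix c A₂ h *ᵥ x = 0 → obsMatrix c A₁ h *ᵥ x = 0)
    (hlex : ∀ x, IsLexPos A₂ c x → IsLexPos A₁ c x)
    (hobs : ∀ x, obsMatrix c A₁ h *ᵥ x = 0 → IsUnobservable A₁ c x) :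
    ∃ M : Matrix (Fin (h + 1)) (Fin (h + 1)) ℝ, M.IsLowerTriangular ∧ (∀ i, 0 < M i i) ∧
      obsMatrix c A₁ h = M * obsMatrix c A₂ h := by
  obtain ⟨R, hR⟩ := Matrix.exists_mul_eq_one_of_linearIndependent_row hli₂
  set M := obsMatrix c A₁ h * R with hM
  have hfac : obsMatrix c A₁ h = M * obsMatrix c A₂ h := by
    refine Matrix.toLin'.injective (LinearMap.ext fun x => ?_)
    rw [toLin'_apply, toLin'_apply]
    have h1 : obsMatrix c A₂ h *ᵥ (x - R *ᵥ (obsMatrix c A₂ h *ᵥ x)) = 0 := by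
      rw [mulVec_sub, mulVec_mulVec, hR, one_mulVec, sub_self]
    have h2 := hker _ h1
    rw [mulVec_sub, sub_eq_zero] at h2
    rw [h2, hM]
    simp only [mulVec_mulVec, Matrix.mul_assoc]
  obtain ⟨htri, hdiag⟩ := M.isLowerTriangular_of_lex_pos (by
    rintro z ⟨k, hk0, hk⟩
    have hz : obsMatrix c A₂ h *ᵥ (R *ᵥ z) = z := by rw [mulVec_mulVec, hR, one_mulVec]
    have hMz : M *ᵥ z = obsMatrix c A₁ h *ᵥ (R *ᵥ z) := by rw [mulVec_mulVec]
    have hzi : ∀ i : Fin (h + 1), (c ᵥ* A₂ ^ (i : ℕ)) ⬝ᵥ (R *ᵥ z) = z i := fun i => by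
      rw [← obsMatrix_mulVec_apply, hz]
    have hpos₂ : IsLexPos A₂ c (R *ᵥ z) := by
      refine ⟨k, fun j hj => ?_, by rwa [hzi k]⟩
      have := hzi ⟨j, hj.trans k.2⟩
      rw [hk0 ⟨j, hj.trans k.2⟩ hj] at this
      exact this
    have hpos₁ := hlex _ hpos₂
    have hne := hpos₁.not_isUnobservable
    obtain ⟨p, hp0, hp⟩ := hpos₁
    -- If all `h + 1` listed derivatives vanished, the state would be unobservable.
    have hph : p < h + 1 := by
      by_contra hlt
      exact hne (hobs _ (funext fun i => hp0 i (by omega)))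
    rw [hMz]
    exact ⟨⟨p, hph⟩, fun j hj => hp0 j hj, hp⟩)
  have hdet : M.det ≠ 0 := by
    intro h0
    obtain ⟨v, hv, hv0⟩ := Matrix.exists_vecMul_eq_zero_iff.2 h0
    have hinj := Matrix.vecMul_injective_iff.2 hli₁
    refine hv (hinj ?_)
    simp only
    rw [hfac, ← vecMul_vecMul, hv0, zero_vecMul, zero_vecMul]
  rw [det_of_isLowerTriangular M htri, Finset.prod_ne_zero_iff] at hdet
  exact ⟨M, htri, fun i => lt_of_le_of_ne (hdiag i) (hdet i (Finset.mem_univ i)).symm, hfac⟩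

/-- Rank–nullity: the unobservable subspace determines the index. -/
theorem observabilityIndex_add_finrank_ker {n : ℕ} {A : Matrix (Fin n) (Fin n) ℝ} {c : Fin n → ℝ}
    (hc : c ≠ 0) : observabilityIndex c A + 1 +
      Module.finrank ℝ (LinearMap.ker (obsMatrix c A (observabilityIndex c A)).mulVecLin) = n := by
  have hli : LinearIndependent ℝ (obsMatrix c A (observabilityIndex c A)).row :=
    (observabilityIndex_isGreatest c hc A).1
  have h1 := hli.rank_matrix
  have h2 := (obsMatrix c A (observabilityIndex c A)).mulVecLin.finrank_range_add_finrank_ker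
  rw [← Matrix.rank, h1] at h2
  simpa using h2

/-- For mode 2 the chain is exact with gains `1`. For mode 1, row `i` of the factorization expresses
`r i` as a positive multiple of `c ᵥ* A₁ ^ i` plus earlier functionals; applying `A₁` and then using
row `i + 1` yields the next chain step. -/
theorem IsIntegratorChain.of_lowerTriangular {n h : ℕ} {A₁ A₂ : Matrix (Fin n) (Fin n) ℝ}
    {c : Fin n → ℝ} {M : Matrix (Fin (h + 1)) (Fin (h + 1)) ℝ} (htri : M.IsLowerTriangular)
    (hdiag : ∀ i, 0 < M i i) (hfac : obsMatrix c A₁ h = M * obsMatrix c A₂ h)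
    (hlast₁ : c ᵥ* A₁ ^ (h + 1) ∈ Submodule.span ℝ ((fun i => c ᵥ* A₁ ^ i) '' Set.Iic h))
    (hlast₂ : c ᵥ* A₂ ^ (h + 1) ∈ Submodule.span ℝ ((fun i => c ᵥ* A₂ ^ i) '' Set.Iic h))
    (hagree : ∀ x, obsMatrix c A₁ h *ᵥ x = 0 → A₁ *ᵥ x = A₂ *ᵥ x) :
    IsIntegratorChain A₁ A₂ h (fun i => c ᵥ* A₂ ^ i) := by
  set r : ℕ → Fin n → ℝ := fun i => c ᵥ* A₂ ^ i with hr
  have hIio : ∀ i : ℕ, Set.Iio (i + 1) = Set.Iic i := fun i => by ext; simp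
  have hmono : ∀ {s t : Set ℕ}, s ⊆ t → Submodule.span ℝ (r '' s) ≤ Submodule.span ℝ (r '' t) :=
    fun hst => Submodule.span_mono (Set.image_mono hst)
  have hrow : ∀ i ≤ h, ∃ m > (0 : ℝ),
      c ᵥ* A₁ ^ i - m • r i ∈ Submodule.span ℝ (r '' Set.Iio i) := by
    intro i hi
    set k : Fin (h + 1) := ⟨i, Nat.lt_succ_of_le hi⟩ with hk
    refine ⟨M k k, hdiag k, ?_⟩
    have h1 : c ᵥ* A₁ ^ i = ∑ j, M k j • r j := by
      have h2 : (obsMatrix c A₁ h) k = (M * obsMatrix c A₂ h) k := by rw [hfac]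
      have h3 : (M * obsMatrix c A₂ h) k = ∑ j, M k j • r j := by
        ext l
        simp [Matrix.mul_apply, hr, obsMatrix]
      exact h2.trans h3
    rw [h1, ← Finset.add_sum_erase _ _ (Finset.mem_univ k), add_sub_cancel_left]
    refine Submodule.sum_mem _ fun j hj => ?_
    rcases lt_or_gt_of_ne (Finset.ne_of_mem_erase hj) with hlt | hlt
    · exact Submodule.smul_mem _ _ (Submodule.subset_span ⟨j, hlt, rfl⟩)
    · rw [htri hlt, zero_smul]
      exact Submodule.zero_mem _
  -- Stated for `i = h` as well, where there is no row `i + 1` and `hlast₁` replaces it.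
  have hvec : ∀ i ≤ h, (∀ j < i, r j ᵥ* A₁ ∈ Submodule.span ℝ (r '' Set.Iic i)) →
      ∃ m > (0 : ℝ), r i ᵥ* A₁ - m⁻¹ • c ᵥ* A₁ ^ (i + 1) ∈ Submodule.span ℝ (r '' Set.Iic i) := by
    intro i hi hlow
    obtain ⟨m, hm, hq⟩ := hrow i hi
    refine ⟨m, hm, ?_⟩
    have hle : Submodule.span ℝ (r '' Set.Iio i) ≤
        (Submodule.span ℝ (r '' Set.Iic i)).comap A₁.vecMulLinear := by
      rw [Submodule.span_le]
      rintro _ ⟨j, hj, rfl⟩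
      exact hlow j hj
    have h1 : (c ᵥ* A₁ ^ i - m • r i) ᵥ* A₁ ∈ Submodule.span ℝ (r '' Set.Iic i) := hle hq
    have h2 : r i ᵥ* A₁ - m⁻¹ • c ᵥ* A₁ ^ (i + 1) =
        -(m⁻¹ • ((c ᵥ* A₁ ^ i - m • r i) ᵥ* A₁)) := by
      rw [sub_vecMul, smul_vecMul, vecMul_pow_succ, smul_sub, smul_smul, inv_mul_cancel₀ hm.ne',
        one_smul]
      abel
    rw [h2]
    exact Submodule.neg_mem _ (Submodule.smul_mem _ _ h1)
  have hstep : ∀ i < h, ∃ a > (0 : ℝ),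
      r i ᵥ* A₁ - a • r (i + 1) ∈ Submodule.span ℝ (r '' Set.Iic i) := by
    intro i
    induction i using Nat.strong_induction_on with
    | _ i ih =>
      intro hi
      obtain ⟨m, hm, h1⟩ := hvec i hi.le fun j hj => by
        obtain ⟨a, -, ha⟩ := ih j hj (hj.trans hi)
        have h2 : r (j + 1) ∈ Submodule.span ℝ (r '' Set.Iic i) :=
          Submodule.subset_span ⟨j + 1, hj, rfl⟩
        have h3 := Submodule.add_mem _ (hmono (Set.Iic_subset_Iic.2 hj.le) ha)
          (Submodule.smul_mem _ a h2)
        rwa [sub_add_cancel] at h3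
      obtain ⟨m', hm', h2⟩ := hrow (i + 1) hi
      rw [hIio] at h2
      -- The gain is the ratio of consecutive diagonal entries of `M`.
      refine ⟨m⁻¹ * m', by positivity, ?_⟩
      have h3 := Submodule.add_mem _ h1 (Submodule.smul_mem _ m⁻¹ h2)
      rwa [smul_sub, smul_smul, sub_add_sub_cancel] at h3
  have hstep₂ : ∀ i < h, ∃ a > (0 : ℝ),
      r i ᵥ* A₂ - a • r (i + 1) ∈ Submodule.span ℝ (r '' Set.Iic i) := by
    intro i _
    refine ⟨1, one_pos, ?_⟩
    rw [one_smul, show r (i + 1) = r i ᵥ* A₂ from vecMul_pow_succ c A₂ i, sub_self]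
    exact Submodule.zero_mem _
  refine ⟨hstep, hstep₂, ?_, ?_, fun x hx => ?_⟩
  · obtain ⟨m, hm, h1⟩ := hvec h le_rfl fun j hj => by
      obtain ⟨a, -, ha⟩ := hstep j hj
      have h2 : r (j + 1) ∈ Submodule.span ℝ (r '' Set.Iic h) :=
        Submodule.subset_span ⟨j + 1, hj, rfl⟩
      have h3 := Submodule.add_mem _ (hmono (Set.Iic_subset_Iic.2 hj.le) ha)
        (Submodule.smul_mem _ a h2)
      rwa [sub_add_cancel] at h3
    have hle : Submodule.span ℝ ((fun i => c ᵥ* A₁ ^ i) '' Set.Iic h) ≤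
        Submodule.span ℝ (r '' Set.Iic h) := by
      rw [Submodule.span_le]
      rintro _ ⟨i, hi, rfl⟩
      obtain ⟨m, -, h2⟩ := hrow i hi
      have h3 : r i ∈ Submodule.span ℝ (r '' Set.Iic h) := Submodule.subset_span ⟨i, hi, rfl⟩
      have hsub : Set.Iio i ⊆ Set.Iic h := Set.Iio_subset_Iic_self.trans (Set.Iic_subset_Iic.2 hi)
      have h4 := Submodule.add_mem _ (hmono hsub h2) (Submodule.smul_mem _ m h3)
      rw [sub_add_cancel] at h4
      exact h4
    have h2 := Submodule.add_mem _ h1 (Submodule.smul_mem _ m⁻¹ (hle hlast₁))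
    rwa [sub_add_cancel] at h2
  · rw [vecMul_pow_succ] at hlast₂
    exact hlast₂
  · refine hagree x ?_
    rw [hfac, ← mulVec_mulVec]
    have h0 : obsMatrix c A₂ h *ᵥ x = 0 := funext fun i => hx i (Nat.lt_succ_iff.1 i.2)
    rw [h0, mulVec_zero]

end Algebra

/-! ### Necessity of the algebraic conditions, and the equivalence -/

theorem obsMatrix_conditions_of_rightUnique {n : ℕ} {A₁ A₂ : Matrix (Fin n) (Fin n) ℝ}
    {c : Fin n → ℝ}
    (huniq : ∀ (ξ : Fin n → ℝ) (x : ℝ → Fin n → ℝ), IsFilippovSolution A₁ A₂ 0 0 c 0 ξ x →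
      IsRightUnique A₁ A₂ 0 0 c 0 ξ x) :
    observabilityIndex c A₁ = observabilityIndex c A₂ ∧
      (∃ M : Matrix (Fin (observabilityIndex c A₁ + 1)) (Fin (observabilityIndex c A₁ + 1)) ℝ,
        M.IsLowerTriangular ∧ (∀ i, 0 < M i i) ∧
          obsMatrix c A₁ (observabilityIndex c A₁) =
            M * obsMatrix c A₂ (observabilityIndex c A₁)) ∧
      ∀ x : Fin n → ℝ, obsMatrix c A₁ (observabilityIndex c A₁) *ᵥ x = 0 →
        A₁ *ᵥ x = A₂ *ᵥ x := by
  have key : ∀ ξ, (IsUnobservable A₁ c ξ ∨ IsLexPos A₁ c (-ξ)) →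
      (IsUnobservable A₂ c ξ ∨ IsLexPos A₂ c ξ) →
      IsUnobservable A₁ c ξ ∧ IsUnobservable A₂ c ξ ∧ A₁ *ᵥ ξ = A₂ *ᵥ ξ := fun ξ =>
    isUnobservable_of_rightUnique huniq
  have h12 : ∀ ξ, IsUnobservable A₁ c ξ → IsUnobservable A₂ c ξ ∧ A₁ *ᵥ ξ = A₂ *ᵥ ξ := by
    intro ξ hξ
    rcases isUnobservable_or_isLexPos A₂ c ξ with h | h | h
    · exact (key ξ (Or.inl hξ) (Or.inl h)).2
    · exact (key ξ (Or.inl hξ) (Or.inr h)).2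
    -- Unobservability is symmetric under `ξ ↦ -ξ`, so the sign can be flipped to suit mode 2.
    · have := key (-ξ) (Or.inl (isUnobservable_neg.2 hξ)) (Or.inr h)
      exact absurd this.2.1 h.not_isUnobservable
  have h21 : ∀ ξ, IsUnobservable A₂ c ξ → IsUnobservable A₁ c ξ := by
    intro ξ hξ
    rcases isUnobservable_or_isLexPos A₁ c ξ with h | h | h
    · exact h
    · have := key (-ξ) (Or.inr (by rwa [neg_neg])) (Or.inl (isUnobservable_neg.2 hξ))
      exact isUnobservable_neg.1 this.1
    · exact (key ξ (Or.inr h) (Or.inl hξ)).1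
  -- Otherwise mode 1 would be unobservable at `ξ` or leave to the negative side, while mode 2
  -- leaves to the positive side.
  have hlex : ∀ ξ, IsLexPos A₂ c ξ → IsLexPos A₁ c ξ := by
    intro ξ hξ
    rcases isUnobservable_or_isLexPos A₁ c ξ with h | h | h
    · exact absurd (h12 ξ h).1 hξ.not_isUnobservable
    · exact h
    · exact absurd (key ξ (Or.inr h) (Or.inr hξ)).2.1 hξ.not_isUnobservable
  have hagree : ∀ x : Fin n → ℝ, obsMatrix c A₁ (observabilityIndex c A₁) *ᵥ x = 0 →
      A₁ *ᵥ x = A₂ *ᵥ x := fun x hx => (h12 x (isUnobservable_iff.2 hx)).2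
  by_cases hc : c = 0
  · subst hc
    -- For `c = 0` both indices are `0` by convention and both matrices vanish, so the identity
    -- serves as `M`.
    refine ⟨by rw [observabilityIndex_zero, observabilityIndex_zero], ⟨1, ?_, by simp, ?_⟩, hagree⟩
    · exact blockTriangular_one
    · ext i j
      simp [obsMatrix]
  · have hker : LinearMap.ker (obsMatrix c A₁ (observabilityIndex c A₁)).mulVecLin =
        LinearMap.ker (obsMatrix c A₂ (observabilityIndex c A₂)).mulVecLin := by
      ext x
      simp only [LinearMap.mem_ker, mulVecLin_apply, ← isUnobservable_iff]
      exact ⟨fun h => (h12 x h).1, h21 x⟩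
    have hidx : observabilityIndex c A₁ = observabilityIndex c A₂ := by
      have h1 := observabilityIndex_add_finrank_ker (A := A₁) hc
      have h2 := observabilityIndex_add_finrank_ker (A := A₂) hc
      rw [hker] at h1
      omega
    refine ⟨hidx, exists_isLowerTriangular_obsMatrix (observabilityIndex_isGreatest c hc A₁).1 ?_ ?_
      hlex fun x => isUnobservable_iff.2, hagree⟩
    · rw [hidx]
      exact (observabilityIndex_isGreatest c hc A₂).1
    · intro x hx
      rw [hidx] at hx
      exact isUnobservable_iff.1 (h21 x (isUnobservable_iff.2 hx))

/-- Bimodal piecewise linear systems (`e₁ = e₂ = 0`, `f = 0`): uniqueness of every Filippov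
solution, on the whole time axis or only to the right of the initial time, is equivalent to the
three algebraic conditions on `(c, A₁, A₂)`. -/
theorem corollary1 {n : ℕ} (A₁ A₂ : Matrix (Fin n) (Fin n) ℝ) (c : Fin n → ℝ) :
    List.TFAE [
      ∀ (ξ : Fin n → ℝ) (x : ℝ → Fin n → ℝ), IsFilippovSolution A₁ A₂ 0 0 c 0 ξ x →
        IsUniqueSolution A₁ A₂ 0 0 c 0 ξ x,
      ∀ (ξ : Fin n → ℝ) (x : ℝ → Fin n → ℝ), IsFilippovSolution A₁ A₂ 0 0 c 0 ξ x →
        IsRightUnique A₁ A₂ 0 0 c 0 ξ x,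
      observabilityIndex c A₁ = observabilityIndex c A₂ ∧
        (∃ M : Matrix (Fin (observabilityIndex c A₁ + 1)) (Fin (observabilityIndex c A₁ + 1)) ℝ,
          M.IsLowerTriangular ∧ (∀ i, 0 < M i i) ∧
            obsMatrix c A₁ (observabilityIndex c A₁) =
              M * obsMatrix c A₂ (observabilityIndex c A₁)) ∧
        ∀ x : Fin n → ℝ, obsMatrix c A₁ (observabilityIndex c A₁) *ᵥ x = 0 →
          A₁ *ᵥ x = A₂ *ᵥ x] := by
  tfae_have 1 → 2 := fun h ξ x hx x' hx' => ⟨1, one_pos, fun t _ => h ξ x hx x' hx' t⟩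
  tfae_have 2 → 3 := obsMatrix_conditions_of_rightUnique
  tfae_have 3 → 1 := by
    rintro ⟨hidx, ⟨M, htri, hdiag, hfac⟩, hagree⟩ ξ x hx x' hx' t
    have hlast₂ := vecMul_pow_observabilityIndex_succ_mem c A₂
    rw [← hidx] at hlast₂
    exact (IsIntegratorChain.of_lowerTriangular htri hdiag hfac
      (vecMul_pow_observabilityIndex_succ_mem c A₁) hlast₂ hagree).unique (by simp) hx hx' t
  tfae_finish
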